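/- Let $d\in\mathbb{N}$ and fix a step size $\Delta t>0$. Let $\mu:\mathbb{R}^d\to\mathbb{R}^d$ be a function (the drift), let $\sigma:\mathbb{R}^d\to\mathbb{R}^{d\times d}$ be measurable (the volatility), and for $i=1,\dots,d$ let $p_i:\mathbb{R}^d\times\mathbb{R}^d\to(0,1)$ be measurable. The skew-symmetric scheme is the Markov chain on $\mathbb{R}^d$ whose transition from $X^n=x$ to $X^{n+1}$ is as follows: draw $\nu=(\nu_1,\dots,\nu_d)\sim N(0,I_d)$; given $\nu$, draw independent signs $b_1,\dots,b_d$ with $b_i=+1$ with probability $p_i(x,\nu)$ and $b_i=-1$ otherwise; set $$X^{n+1}=x+\Delta t^{1/2}\,\sigma(x)\,(b_1\nu_1,\dots,b_d\nu_d)^{T}.$$ Let $P$ be its Markov kernel and $P^n$ the $n$-step kernel. Write $\|\cdot\|$ for the Euclidean norm and $\|\cdot\|_\infty$ for the supremum norm on $\mathbb{R}^d$. Assume: 1. $\sigma_{i,j}(x)=0$ for all $i\neq j$ and $x\in\mathbb{R}^d$. 2. There are $M>N>0$ such that $N\le\sigma_{i,i}(x)\le M$ for all $i$ and all $x\in\mathbb{R}^d$.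 3. For every $i$, $$\lim_{\substack{\|x\|\to\infty\\ x_i<-\|x\|_\infty/2}}\mu_i(x)=+\infty,\qquad \lim_{\substack{\|x\|\to\infty\\ x_i>\|x\|_\infty/2}}\mu_i(x)=-\infty.$$ 4. For every $i$, there is a function $g_i:\mathbb{R}^d\times\mathbb{R}\to(0,1)$ with $p_i(x,\nu)=g_i(x,\nu_i)$ for all $x,\nu\in\mathbb{R}^d$; $g_i$ is bounded away from zero on compact subsets of $\mathbb{R}^d\times\mathbb{R}$; and, as $(x,t)$ ranges over $\mathbb{R}^d\times\mathbb{R}$, $$\lim_{t\,\mu_i(x)\to+\infty}g_i(x,t)=1,\qquad \lim_{t\,\mu_i(x)\to-\infty}g_i(x,t)=0.$$ Then the chain has an invariant probability measure $\pi_{\Delta t}$ with finite moments of all orders, i.e. $\int\|x\|^k\,\pi_{\Delta t}(dx)<\infty$ for all $k\in\mathbb{N}$, and there exist $C>0$, $\lambda>0$ and a function $V:\mathbb{R}^d\to[1,\infty)$ such that for all $n\in\mathbb{N}$ and $x\in\mathbb{R}^d$ $$\|P^n(x,\cdot)-\pi_{\Delta t}\|_{TV}\le C\,V(x)\,e^{-\lambda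 n},$$ where $\|\cdot\|_{TV}$ is the total variation norm. -/

import Mathlib

open MeasureTheory ProbabilityTheory

namespace SkewSymmetric

/-- The supremum norm on `ℝ^d` (`‖x‖` itself is the Euclidean norm). -/
noncomputable def supNorm {d : ℕ} (x : EuclideanSpace ℝ (Fin d)) : ℝ :=
  ‖(WithLp.ofLp x : Fin d → ℝ)‖

/-- Conditional law of the sign vector `b = (b_1, …, b_d)` given the current state `x` and the
Gaussian vector `ν`: the `b_i` are independent, `b_i = 1` with probability `p_i(x, ν)` and
`b_i = -1` otherwise. -/
noncomputable def flipLaw {d : ℕ}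
    (p : Fin d → EuclideanSpace ℝ (Fin d) → EuclideanSpace ℝ (Fin d) → unitInterval)
    (x ν : EuclideanSpace ℝ (Fin d)) : Measure (Fin d → ℝ) :=
  Measure.pi fun i => bernoulliMeasure (1 : ℝ) (-1) (p i x ν)

instance instIsProbabilityMeasureFlipLaw {d : ℕ}
    (p : Fin d → EuclideanSpace ℝ (Fin d) → EuclideanSpace ℝ (Fin d) → unitInterval)
    (x ν : EuclideanSpace ℝ (Fin d)) : IsProbabilityMeasure (flipLaw p x ν) := by
  unfold flipLaw; infer_instance

/-- The update `x + Δt^{1/2} σ(x) (b ∗ ν)`, with `∗` the element-wise product. -/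
noncomputable def update {d : ℕ} (Δt : ℝ)
    (σ : EuclideanSpace ℝ (Fin d) → Matrix (Fin d) (Fin d) ℝ)
    (x ν : EuclideanSpace ℝ (Fin d)) (b : Fin d → ℝ) : EuclideanSpace ℝ (Fin d) :=
  x + √Δt • WithLp.toLp 2 ((σ x).mulVec fun i => b i * ν i)

/-- Law of `X^{n+1}` given `X^n = x`: draw `ν ∼ N(0, I_d)`, then the signs `b` given `(x, ν)`,
then apply the update. -/
noncomputable def stepLaw {d : ℕ} (Δt : ℝ)
    (σ : EuclideanSpace ℝ (Fin d) → Matrix (Fin d) (Fin d) ℝ)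
    (p : Fin d → EuclideanSpace ℝ (Fin d) → EuclideanSpace ℝ (Fin d) → unitInterval)
    (x : EuclideanSpace ℝ (Fin d)) : Measure (EuclideanSpace ℝ (Fin d)) :=
  (stdGaussian (EuclideanSpace ℝ (Fin d))).bind fun ν => (flipLaw p x ν).map (update Δt σ x ν)

theorem measurable_flipLaw {d : ℕ}
    {p : Fin d → EuclideanSpace ℝ (Fin d) → EuclideanSpace ℝ (Fin d) → unitInterval}
    (hp : ∀ i, Measurable fun z : EuclideanSpace ℝ (Fin d) × EuclideanSpace ℝ (Fin d) =>
      p i z.1 z.2) :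
    Measurable fun z : EuclideanSpace ℝ (Fin d) × EuclideanSpace ℝ (Fin d) =>
      flipLaw p z.1 z.2 := by
  refine Measurable.measure_of_isPiSystem_of_isProbabilityMeasure generateFrom_pi.symm
    isPiSystem_pi ?_
  rintro _ ⟨s, hs, rfl⟩
  simp only [flipLaw, Measure.pi_pi]
  refine Finset.measurable_prod _ fun i _ => ?_
  have h1 : Measurable fun z : EuclideanSpace ℝ (Fin d) × EuclideanSpace ℝ (Fin d) =>
      ENNReal.ofReal (p i z.1 z.2 : ℝ) := by have := hp i; fun_prop
  have h2 : Measurable fun z : EuclideanSpace ℝ (Fin d) × EuclideanSpace ℝ (Fin d) =>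
      ENNReal.ofReal (1 - (p i z.1 z.2 : ℝ)) := by have := hp i; fun_prop
  have h3 : ∀ q : unitInterval, bernoulliMeasure (1 : ℝ) (-1) q (s i)
      = ENNReal.ofReal (q : ℝ) * Measure.dirac (1 : ℝ) (s i)
        + ENNReal.ofReal (1 - (q : ℝ)) * Measure.dirac (-1 : ℝ) (s i) := by
    intro q
    have e1 : ((unitInterval.toNNReal q : NNReal) : ENNReal) = ENNReal.ofReal (q : ℝ) := by
      rw [ENNReal.ofReal, ENNReal.coe_inj]; ext; simp [q.2.1]
    have e2 : ((unitInterval.toNNReal (unitInterval.symm q) : NNReal) : ENNReal)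
        = ENNReal.ofReal (1 - (q : ℝ)) := by
      rw [ENNReal.ofReal, ENNReal.coe_inj]; ext; simp [q.2.2]
    rw [bernoulliMeasure_def, Measure.add_apply, Measure.smul_apply, Measure.smul_apply,
      ENNReal.smul_def, ENNReal.smul_def, e1, e2, smul_eq_mul, smul_eq_mul]
  simp only [h3]
  fun_prop

theorem measurable_update {d : ℕ} (Δt : ℝ)
    {σ : EuclideanSpace ℝ (Fin d) → Matrix (Fin d) (Fin d) ℝ}
    (hσ : ∀ i j, Measurable fun x => σ x i j) :
    Measurable fun z : (EuclideanSpace ℝ (Fin d) × EuclideanSpace ℝ (Fin d)) × (Fin d → ℝ) =>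
      update Δt σ z.1.1 z.1.2 z.2 := by
  unfold update
  have h : Measurable fun z :
      (EuclideanSpace ℝ (Fin d) × EuclideanSpace ℝ (Fin d)) × (Fin d → ℝ) =>
      (σ z.1.1).mulVec fun i => z.2 i * z.1.2 i := by
    refine measurable_pi_lambda _ fun i => ?_
    simp only [Matrix.mulVec, dotProduct]
    refine Finset.measurable_sum _ fun j _ => ?_
    have := (hσ i j).comp (measurable_fst.comp measurable_fst :
      Measurable fun z : (EuclideanSpace ℝ (Fin d) × EuclideanSpace ℝ (Fin d)) × (Fin d → ℝ) =>
        z.1.1)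
    simp only [Function.comp_def] at this
    fun_prop
  fun_prop

theorem measurable_map_flipLaw {d : ℕ} (Δt : ℝ)
    {σ : EuclideanSpace ℝ (Fin d) → Matrix (Fin d) (Fin d) ℝ}
    {p : Fin d → EuclideanSpace ℝ (Fin d) → EuclideanSpace ℝ (Fin d) → unitInterval}
    (hσ : ∀ i j, Measurable fun x => σ x i j)
    (hp : ∀ i, Measurable fun z : EuclideanSpace ℝ (Fin d) × EuclideanSpace ℝ (Fin d) =>
      p i z.1 z.2) :
    Measurable fun z : EuclideanSpace ℝ (Fin d) × EuclideanSpace ℝ (Fin d) =>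
      (flipLaw p z.1 z.2).map (update Δt σ z.1 z.2) := by
  let κ : Kernel (EuclideanSpace ℝ (Fin d) × EuclideanSpace ℝ (Fin d)) (Fin d → ℝ) :=
    ⟨fun z => flipLaw p z.1 z.2, measurable_flipLaw hp⟩
  have hκ : IsMarkovKernel κ := 
    ⟨fun z => inferInstanceAs (IsProbabilityMeasure (flipLaw p z.1 z.2))⟩
  refine Measure.measurable_of_measurable_coe _ fun A hA => ?_
  have hm : ∀ z : EuclideanSpace ℝ (Fin d) × EuclideanSpace ℝ (Fin d),
      Measurable (update Δt σ z.1 z.2) := fun z =>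
    (measurable_update Δt hσ).comp (measurable_const.prodMk measurable_id :
      Measurable fun b : Fin d → ℝ => (z, b))
  have := Kernel.measurable_kernel_prodMk_left (κ := κ) (measurable_update Δt hσ hA)
  have e : (fun z : EuclideanSpace ℝ (Fin d) × EuclideanSpace ℝ (Fin d) =>
      (flipLaw p z.1 z.2).map (update Δt σ z.1 z.2) A) = fun z => κ z (Prod.mk z ⁻¹'
        ((fun z : (EuclideanSpace ℝ (Fin d) × EuclideanSpace ℝ (Fin d)) × (Fin d → ℝ) =>
          update Δt σ z.1.1 z.1.2 z.2) ⁻¹' A)) := by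
    funext z
    rw [Measure.map_apply (hm z) hA]
    rfl
  rw [e]
  exact this

theorem measurable_stepLaw {d : ℕ} (Δt : ℝ)
    {σ : EuclideanSpace ℝ (Fin d) → Matrix (Fin d) (Fin d) ℝ}
    {p : Fin d → EuclideanSpace ℝ (Fin d) → EuclideanSpace ℝ (Fin d) → unitInterval}
    (hσ : ∀ i j, Measurable fun x => σ x i j)
    (hp : ∀ i, Measurable fun z : EuclideanSpace ℝ (Fin d) × EuclideanSpace ℝ (Fin d) =>
      p i z.1 z.2) :
    Measurable (stepLaw Δt σ p) := by
  have h := measurable_map_flipLaw Δt hσ hp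
  refine Measure.measurable_of_measurable_coe _ fun A hA => ?_
  have e : ∀ x, stepLaw Δt σ p x A = ∫⁻ ν, (flipLaw p x ν).map (update Δt σ x ν) A
      ∂(stdGaussian (EuclideanSpace ℝ (Fin d))) := fun x =>
    Measure.bind_apply hA (h.comp (measurable_const.prodMk measurable_id :
      Measurable fun ν : EuclideanSpace ℝ (Fin d) => (x, ν))).aemeasurable
  simp only [e]
  exact ((Measure.measurable_coe hA).comp h).lintegral_prod_right'

/-- The Markov kernel `P` of the skew-symmetric scheme. -/
noncomputable def kernel {d : ℕ} (Δt : ℝ)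
    (σ : EuclideanSpace ℝ (Fin d) → Matrix (Fin d) (Fin d) ℝ)
    (p : Fin d → EuclideanSpace ℝ (Fin d) → EuclideanSpace ℝ (Fin d) → unitInterval)
    (hσ : ∀ i j, Measurable fun x => σ x i j)
    (hp : ∀ i, Measurable fun z : EuclideanSpace ℝ (Fin d) × EuclideanSpace ℝ (Fin d) =>
      p i z.1 z.2) :
    Kernel (EuclideanSpace ℝ (Fin d)) (EuclideanSpace ℝ (Fin d)) where
  toFun := stepLaw Δt σ p
  measurable' := measurable_stepLaw Δt hσ hp

instance instIsMarkovKernelKernel {d : ℕ} (Δt : ℝ)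
    (σ : EuclideanSpace ℝ (Fin d) → Matrix (Fin d) (Fin d) ℝ)
    (p : Fin d → EuclideanSpace ℝ (Fin d) → EuclideanSpace ℝ (Fin d) → unitInterval)
    (hσ : ∀ i j, Measurable fun x => σ x i j)
    (hp : ∀ i, Measurable fun z : EuclideanSpace ℝ (Fin d) × EuclideanSpace ℝ (Fin d) =>
      p i z.1 z.2) :
    IsMarkovKernel (kernel Δt σ p hσ hp) := by
  refine ⟨fun x => ⟨?_⟩⟩
  change stepLaw Δt σ p x Set.univ = 1
  have hx : Measurable fun ν : EuclideanSpace ℝ (Fin d) =>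
      (flipLaw p x ν).map (update Δt σ x ν) :=
    (measurable_map_flipLaw Δt hσ hp).comp (measurable_const.prodMk measurable_id :
      Measurable fun ν : EuclideanSpace ℝ (Fin d) => (x, ν))
  have hm : ∀ ν, Measurable (update Δt σ x ν) := fun ν =>
    (measurable_update Δt hσ).comp (measurable_const.prodMk measurable_id :
      Measurable fun b : Fin d → ℝ => ((x, ν), b))
  rw [stepLaw, Measure.bind_apply MeasurableSet.univ hx.aemeasurable]
  simp [Measure.map_apply (hm _) MeasurableSet.univ]

/-- Powers of a Markov kernel (`P ^ n` is the `n`-fold composition) are Markov kernels. -/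
instance instIsMarkovKernelPow {α : Type*} [MeasurableSpace α] (κ : Kernel α α) [IsMarkovKernel κ] (n : ℕ) :
    IsMarkovKernel (κ ^ n) := by
  induction n with
  | zero => rw [pow_zero]; exact inferInstanceAs (IsMarkovKernel (Kernel.id : Kernel α α))
  | succ n ih => rw [pow_succ]; exact inferInstanceAs (IsMarkovKernel ((κ ^ n) ∘ₖ κ))

/-- The total variation norm `‖μ - ν‖_TV` of the difference of two finite measures. -/
noncomputable def tvNorm {α : Type*} [MeasurableSpace α] (μ ν : Measure α)
    [IsFiniteMeasure μ] [IsFiniteMeasure ν] : ℝ :=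
  ((μ.toSignedMeasure - ν.toSignedMeasure).totalVariation Set.univ).toReal

end SkewSymmetric

/-!
Because `σ` is diagonal and `p i` sees only the `i`-th noise coordinate, the kernel is a product of
one-dimensional skew Gaussian steps. A coordinate which is large relative to the others steps
towards the origin with probability close to one, typically by at least `√Δt N |ν i|`, so that the
mean of its `cosh` is multiplied by approximately `E exp (-√Δt N |ν i|) < 1`. Hence
`1 + ∑ i, cosh (x i)` satisfies a geometric drift condition. On bounded sets the step dominates a
fixed multiple of Lebesgue measure on `[-1, 1]ᵈ`, and the theorem of Harris, in the contraction form
of Hairer and Mattingly, gives the invariant measure and the convergence rate; `cosh` dominates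
every power, hence the moments.
-/

namespace SkewSymmetric

open Filter Topology Set

section TotalVariation

variable {α : Type*} [MeasurableSpace α]

theorem exists_tvNorm_eq (μ ν : Measure α) [IsFiniteMeasure μ] [IsFiniteMeasure ν] :
    ∃ S, MeasurableSet S ∧ tvNorm μ ν = (μ.real Sᶜ - ν.real Sᶜ) - (μ.real S - ν.real S) := by
  set s : SignedMeasure α := μ.toSignedMeasure - ν.toSignedMeasure with hs
  set p := s.toJordanDecomposition.posPart
  set q := s.toJordanDecomposition.negPart
  obtain ⟨S, hS, hpS, hqS⟩ : p.MutuallySingular q := s.toJordanDecomposition.mutuallySingular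
  have apply_eq {A : Set α} (hA : MeasurableSet A) : μ.real A - ν.real A = p.real A - q.real A := by
    rw [← s.apply_eq_posPart_real_sub_negPart_real hA]
    simp [hs, hA]
  have hp : p.real S = 0 := by simp [measureReal_def, hpS]
  have hq : q.real Sᶜ = 0 := by simp [measureReal_def, hqS]
  refine ⟨S, hS, ?_⟩
  calc tvNorm μ ν = p.real univ + q.real univ := measureReal_add_apply
    _ = p.real Sᶜ + q.real S := by
      rw [← measureReal_add_measureReal_compl hS, ← measureReal_add_measureReal_compl (μ := q) hS,
        hp, hq, zero_add, add_zero]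
    _ = _ := by rw [apply_eq hS.compl, apply_eq hS, hp, hq]; ring

theorem tvNorm_le_of_forall_abs_sub_le {μ ν : Measure α} [IsFiniteMeasure μ] [IsFiniteMeasure ν]
    {r : ℝ} (h : ∀ A, MeasurableSet A → |μ.real A - ν.real A| ≤ r) : tvNorm μ ν ≤ 2 * r := by
  obtain ⟨S, hS, hμν⟩ := exists_tvNorm_eq μ ν
  linarith [(abs_le.1 (h _ hS)).1, (abs_le.1 (h _ hS.compl)).2]

end TotalVariation

section SetwiseLimits

variable {α : Type*} [MeasurableSpace α] {μ : ℕ → Measure α}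

theorem lintegral_le_of_tendsto_measure {π : Measure α}
    (h : ∀ A, MeasurableSet A → Tendsto (fun n => μ n A) atTop (𝓝 (π A)))
    {f : α → ENNReal} {u : ℕ → ENNReal} {c : ENNReal} (hu : ∀ n, ∫⁻ x, f x ∂μ n ≤ u n)
    (huc : Tendsto u atTop (𝓝 c)) : ∫⁻ x, f x ∂π ≤ c := by
  rw [lintegral_eq_nnreal]
  refine iSup₂_le fun φ hφ => ?_
  have simple_tendsto : Tendsto (fun n => (φ.map ((↑) : NNReal → ENNReal)).lintegral (μ n)) atTop
      (𝓝 ((φ.map ((↑) : NNReal → ENNReal)).lintegral π)) := by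
    simp only [SimpleFunc.map_lintegral]
    refine tendsto_finsetSum _ fun y _ => ?_
    exact ENNReal.Tendsto.const_mul (h _ (φ.measurableSet_preimage _)) (Or.inr ENNReal.coe_ne_top)
  refine le_of_tendsto_of_tendsto' simple_tendsto huc fun n => le_trans ?_ (hu n)
  rw [← SimpleFunc.lintegral_eq_lintegral]
  exact lintegral_mono hφ

theorem hasSum_of_tendstoUniformlyOn_measureReal [∀ n, IsFiniteMeasure (μ n)] {m : Set α → ℝ}
    (h : TendstoUniformlyOn (fun n A => (μ n).real A) m atTop {A | MeasurableSet A})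
    {f : ℕ → Set α} (hf : ∀ i, MeasurableSet (f i)) (hd : Pairwise (Function.onFun Disjoint f)) :
    HasSum (fun i => m (f i)) (m (⋃ i, f i)) := by
  have m_nonneg (i : ℕ) : 0 ≤ m (f i) :=
    ge_of_tendsto' (h.tendsto_at (hf i)) fun _ => measureReal_nonneg
  have measurable_partial (k : ℕ) : MeasurableSet (⋃ i ∈ Finset.range k, f i) :=
    Finset.measurableSet_biUnion _ fun i _ => hf i
  have m_partial (k : ℕ) : ∑ i ∈ Finset.range k, m (f i) = m (⋃ i ∈ Finset.range k, f i) := by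
    refine tendsto_nhds_unique (tendsto_finsetSum _ fun i _ => h.tendsto_at (hf i)) ?_
    refine (h.tendsto_at (measurable_partial k)).congr fun n => ?_
    exact measureReal_biUnion_finset (fun i _ j _ hij => hd hij) fun i _ => hf i
  have iUnion_partial : ⋃ k, ⋃ i ∈ Finset.range k, f i = ⋃ i, f i := by
    ext x
    simp only [mem_iUnion, Finset.mem_range, exists_prop]
    exact ⟨fun ⟨_, i, _, hi⟩ => ⟨i, hi⟩, fun ⟨i, hi⟩ => ⟨i + 1, i, i.lt_succ_self, hi⟩⟩
  have tendsto_partial (n : ℕ) :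
      Tendsto (fun k => (μ n).real (⋃ i ∈ Finset.range k, f i)) atTop
        (𝓝 ((μ n).real (⋃ i, f i))) := by
    have mono : Monotone fun k => ⋃ i ∈ Finset.range k, f i := fun a b hab =>
      biUnion_subset_biUnion_left fun i hi => Finset.range_mono hab hi
    rw [← iUnion_partial]
    exact (ENNReal.tendsto_toReal (measure_ne_top _ _)).comp (tendsto_measure_iUnion_atTop mono)
  rw [hasSum_iff_tendsto_nat_of_nonneg m_nonneg]
  simp only [m_partial]
  -- uniformity over measurable sets allows the limits in `n` and in `k` to be interchanged
  have unif : TendstoUniformly (fun n k => (μ n).real (⋃ i ∈ Finset.range k, f i))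
      (fun k => m (⋃ i ∈ Finset.range k, f i)) atTop := fun U hU =>
    (h U hU).mono fun n hn k => hn _ (measurable_partial k)
  exact unif.tendsto_of_eventually_tendsto (Eventually.of_forall tendsto_partial)
    (h.tendsto_at (MeasurableSet.iUnion hf))

theorem exists_isProbabilityMeasure_of_tendstoUniformlyOn [∀ n, IsProbabilityMeasure (μ n)]
    {m : Set α → ℝ}
    (h : TendstoUniformlyOn (fun n A => (μ n).real A) m atTop {A | MeasurableSet A}) :
    ∃ π : Measure α, IsProbabilityMeasure π ∧ ∀ A, MeasurableSet A → π.real A = m A := by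
  have m_nonneg (A) (hA : MeasurableSet A) : 0 ≤ m A :=
    ge_of_tendsto' (h.tendsto_at hA) fun _ => measureReal_nonneg
  have m_empty : m ∅ = 0 := tendsto_nhds_unique (h.tendsto_at .empty) (by simp)
  have m_univ : m univ = 1 := tendsto_nhds_unique (h.tendsto_at .univ) (by simp)
  refine ⟨Measure.ofMeasurable (fun A _ => ENNReal.ofReal (m A)) (by simp [m_empty]) ?_, ⟨?_⟩, ?_⟩
  · intro f hf hd
    have sum := hasSum_of_tendstoUniformlyOn_measureReal h hf hd
    rw [← sum.tsum_eq]
    exact ENNReal.ofReal_tsum_of_nonneg (fun i => m_nonneg _ (hf i)) sum.summable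
  · simp [Measure.ofMeasurable_apply _ MeasurableSet.univ, m_univ]
  · intro A hA
    rw [measureReal_def, Measure.ofMeasurable_apply _ hA, ENNReal.toReal_ofReal (m_nonneg A hA)]

end SetwiseLimits

section Minorant

variable {α : Type*}

theorem exists_abs_sub_le_of_abs_sub_le_add {φ w : α → ℝ}
    (h : ∀ x y, |φ x - φ y| ≤ w x + w y) : ∃ t : ℝ, ∀ x, |φ x - t| ≤ w x := by
  rcases isEmpty_or_nonempty α with hα | ⟨⟨x₀⟩⟩
  · exact ⟨0, isEmptyElim⟩
  have le_of_pair (x y) : φ x - w x ≤ φ y + w y := by linarith [(abs_le.1 (h x y)).2]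
  have bdd : BddAbove (range fun x => φ x - w x) :=
    ⟨φ x₀ + w x₀, forall_mem_range.2 fun x => le_of_pair x x₀⟩
  have : Nonempty α := ⟨x₀⟩
  refine ⟨⨆ x, (φ x - w x), fun x => abs_le.2 ⟨?_, ?_⟩⟩
  · linarith [ciSup_le fun y => le_of_pair y x]
  · linarith [le_ciSup bdd x]

variable [MeasurableSpace α] {μ ν η : Measure α} {φ w : α → ℝ}

theorem abs_integral_sub_integral_le_of_le (h : η ≤ μ) (hφ : Integrable φ μ) (hw : Integrable w μ)
    (hφw : ∀ x, |φ x| ≤ w x) :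
    |∫ x, φ x ∂μ - ∫ x, φ x ∂η| ≤ ∫ x, w x ∂μ - ∫ x, w x ∂η := by
  have sub_le := integral_mono_measure h
    (Eventually.of_forall fun x => sub_nonneg.2 (abs_le.1 (hφw x)).2) (hw.sub hφ)
  have add_le := integral_mono_measure h
    (Eventually.of_forall fun x => neg_le_iff_add_nonneg.1 (abs_le.1 (hφw x)).1) (hφ.add hw)
  rw [integral_sub hw hφ, integral_sub (hw.mono_measure h) (hφ.mono_measure h)] at sub_le
  rw [integral_add hφ hw, integral_add (hφ.mono_measure h) (hw.mono_measure h)] at add_le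
  rw [abs_le]
  constructor <;> linarith

theorem abs_integral_sub_integral_le_of_minorant [IsProbabilityMeasure μ] [IsProbabilityMeasure ν]
    (hμ : η ≤ μ) (hν : η ≤ ν) (hφμ : Integrable φ μ) (hφν : Integrable φ ν)
    (hwμ : Integrable w μ) (hwν : Integrable w ν) (h : ∀ x y, |φ x - φ y| ≤ w x + w y) :
    |∫ x, φ x ∂μ - ∫ x, φ x ∂ν| ≤ ∫ x, w x ∂μ + ∫ x, w x ∂ν - 2 * ∫ x, w x ∂η := by
  obtain ⟨t, ht⟩ := exists_abs_sub_le_of_abs_sub_le_add h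
  have bound_μ := abs_integral_sub_integral_le_of_le hμ (hφμ.sub (integrable_const t)) hwμ ht
  have bound_ν := abs_integral_sub_integral_le_of_le hν (hφν.sub (integrable_const t)) hwν ht
  simp only [Pi.sub_apply, integral_sub hφμ (integrable_const t), integral_const, probReal_univ,
    one_smul] at bound_μ
  simp only [Pi.sub_apply, integral_sub hφν (integrable_const t), integral_const, probReal_univ,
    one_smul] at bound_ν
  rw [abs_le] at bound_μ bound_ν ⊢
  constructor <;> linarith [bound_μ.1, bound_μ.2, bound_ν.1, bound_ν.2]

end Minorant

section MarkovKernels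

variable {α : Type*} [MeasurableSpace α] {P : Kernel α α} [IsMarkovKernel P] {w : α → ℝ} {r : ℝ}

theorem integrable_measureReal_apply (μ : Measure α) [IsFiniteMeasure μ] {A : Set α}
    (hA : MeasurableSet A) : Integrable (fun y => (P y).real A) μ := by
  refine Integrable.of_bound (C := 1)
    (Kernel.measurable_coe P hA).ennreal_toReal.aestronglyMeasurable
    (Eventually.of_forall fun y => ?_)
  rw [Real.norm_of_nonneg measureReal_nonneg]
  exact measureReal_le_one

theorem measureReal_pow_succ_apply (P : Kernel α α) [IsMarkovKernel P] (n : ℕ) (x : α) {A : Set α}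
    (hA : MeasurableSet A) : ((P ^ (n + 1)) x).real A = ∫ y, ((P ^ n) y).real A ∂P x := by
  have h := Kernel.pow_add_apply_eq_lintegral P 1 n x hA
  rw [pow_one, add_comm] at h
  rw [measureReal_def, h, ← integral_toReal (Kernel.measurable_coe _ hA).aemeasurable
    (Eventually.of_forall fun y => measure_lt_top _ _)]
  rfl

/-- `P` contracts by the factor `r` the weighted oscillation `sup |φ x - φ y| / (w x + w y)`
(the Lipschitz seminorm for the Hairer–Mattingly distance). Oscillations are described by their
upper bounds `c`, so no supremum, possibly infinite, has to be formed. -/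
def ContractsOscillation (P : Kernel α α) (w : α → ℝ) (r : ℝ) : Prop :=
  ∀ (φ : α → ℝ) (c : ℝ), 0 ≤ c → (∀ x, Integrable φ (P x)) →
    (∀ x y, |φ x - φ y| ≤ c * (w x + w y)) →
    ∀ x y, |∫ z, φ z ∂P x - ∫ z, φ z ∂P y| ≤ c * r * (w x + w y)

namespace ContractsOscillation

variable (hP : ContractsOscillation P w r) (hr0 : 0 ≤ r) (hw : ∀ x, 1 ≤ w x)
include hP hr0 hw

theorem abs_pow_sub_pow_le {A : Set α} (hA : MeasurableSet A) (n : ℕ) (x y : α) :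
    |((P ^ n) x).real A - ((P ^ n) y).real A| ≤ r ^ n * (w x + w y) := by
  induction n generalizing x y with
  | zero =>
    have one_le : 1 ≤ w x + w y := by linarith [hw x, hw y]
    rw [pow_zero r, one_mul]
    refine (abs_sub_le_iff.2 ⟨?_, ?_⟩).trans one_le <;>
      exact (sub_le_self _ measureReal_nonneg).trans measureReal_le_one
  | succ n ih =>
    rw [measureReal_pow_succ_apply P n x hA, measureReal_pow_succ_apply P n y hA, pow_succ]
    exact hP _ _ (pow_nonneg hr0 n) (fun z => integrable_measureReal_apply _ hA) ih x y

variable (hwP : ∀ x, Integrable w (P x))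
include hwP

theorem abs_pow_sub_pow_succ_le {A : Set α} (hA : MeasurableSet A) (n : ℕ) (x : α) :
    |((P ^ n) x).real A - ((P ^ (n + 1)) x).real A| ≤ (w x + ∫ y, w y ∂P x) * r ^ n := by
  have integrable_pow : Integrable (fun y => ((P ^ n) y).real A) (P x) :=
    integrable_measureReal_apply _ hA
  calc |((P ^ n) x).real A - ((P ^ (n + 1)) x).real A|
      = |∫ y, (((P ^ n) x).real A - ((P ^ n) y).real A) ∂P x| := by
        rw [integral_sub (integrable_const _) integrable_pow, measureReal_pow_succ_apply P n x hA]
        simp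
    _ ≤ ∫ y, |((P ^ n) x).real A - ((P ^ n) y).real A| ∂P x := abs_integral_le_integral_abs
    _ ≤ ∫ y, r ^ n * (w x + w y) ∂P x :=
        integral_mono ((integrable_const _).sub integrable_pow).abs
          (((integrable_const _).add (hwP x)).const_mul _)
          fun y => hP.abs_pow_sub_pow_le hr0 hw hA n x y
    _ = (w x + ∫ y, w y ∂P x) * r ^ n := by
        rw [integral_const_mul, integral_add (integrable_const _) (hwP x), mul_comm]
        simp

variable (hr1 : r < 1)
include hr1

theorem exists_tendsto_pow_apply {A : Set α} (hA : MeasurableSet A) :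
    ∃ m : ℝ, ∀ x, Tendsto (fun n => ((P ^ n) x).real A) atTop (𝓝 m) := by
  rcases isEmpty_or_nonempty α with hα | ⟨⟨x₀⟩⟩
  · exact ⟨0, isEmptyElim⟩
  obtain ⟨m, hm⟩ := cauchySeq_tendsto_of_complete (cauchySeq_of_le_geometric r _ hr1
    (f := fun n => ((P ^ n) x₀).real A)
    fun n => hP.abs_pow_sub_pow_succ_le hr0 hw hwP hA n x₀)
  refine ⟨m, fun x => ?_⟩
  have diff_tendsto : Tendsto (fun n => ((P ^ n) x).real A - ((P ^ n) x₀).real A) atTop (𝓝 0) :=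
    squeeze_zero_norm (fun n => hP.abs_pow_sub_pow_le hr0 hw hA n x x₀)
      (by simpa using (tendsto_pow_atTop_nhds_zero_of_lt_one hr0 hr1).mul_const (w x + w x₀))
  simpa using diff_tendsto.add hm

theorem exists_abs_pow_sub_le [Nonempty α] :
    ∃ π : Measure α, IsProbabilityMeasure π ∧ ∀ n x A, MeasurableSet A →
      |((P ^ n) x).real A - π.real A| ≤ (w x + ∫ y, w y ∂P x) * r ^ n / (1 - r) := by
  choose! m hm using fun A hA => hP.exists_tendsto_pow_apply hr0 hw hwP hr1 (A := A) hA
  have rate (n x A) (hA : MeasurableSet A) :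
      |((P ^ n) x).real A - m A| ≤ (w x + ∫ y, w y ∂P x) * r ^ n / (1 - r) :=
    dist_le_of_le_geometric_of_tendsto r _ hr1
      (fun k => hP.abs_pow_sub_pow_succ_le hr0 hw hwP hA k x) (hm A hA x) n
  obtain ⟨x₀⟩ := ‹Nonempty α›
  have unif :
      TendstoUniformlyOn (fun n A => ((P ^ n) x₀).real A) m atTop {A | MeasurableSet A} := by
    have bound_tendsto :
        Tendsto (fun n => (w x₀ + ∫ y, w y ∂P x₀) * r ^ n / (1 - r)) atTop (𝓝 0) := by
      simpa using ((tendsto_pow_atTop_nhds_zero_of_lt_one hr0 hr1).const_mul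
        (w x₀ + ∫ y, w y ∂P x₀)).div_const (1 - r)
    rw [Metric.tendstoUniformlyOn_iff]
    intro ε hε
    filter_upwards [bound_tendsto.eventually (gt_mem_nhds hε)] with n hn A hA
    rw [dist_comm]
    exact (rate n x₀ A hA).trans_lt hn
  obtain ⟨π, hπ, hπm⟩ := exists_isProbabilityMeasure_of_tendstoUniformlyOn unif
  exact ⟨π, hπ, fun n x A hA => hπm A hA ▸ rate n x A hA⟩

end ContractsOscillation

theorem invariant_of_tendsto_pow_apply {π : Measure α} [IsProbabilityMeasure π] {x : α}
    (h : ∀ A, MeasurableSet A → Tendsto (fun n => (P ^ n) x A) atTop (𝓝 (π A))) :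
    P.Invariant π := by
  have : IsProbabilityMeasure (π.bind P) := inferInstance
  -- Fatou's lemma only gives one inequality, but both sides are probability measures
  refine Measure.eq_of_le_of_isProbabilityMeasure (Measure.le_iff.2 fun A hA => ?_)
  rw [Measure.bind_apply hA P.aemeasurable]
  exact lintegral_le_of_tendsto_measure h
    (fun n => (Kernel.pow_succ_apply_eq_lintegral P n x hA).ge)
    ((h A hA).comp (tendsto_add_atTop_nat 1))

end MarkovKernels

section Harris

variable {α : Type*} [MeasurableSpace α] {P : Kernel α α} {V : α → ℝ} {γ K : ℝ}

/-- The geometric drift (Foster–Lyapunov) condition `P V ≤ γ V + K`. It is phrased with the Lebesgue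
integral, so that it includes the integrability of `V` under each `P x`. -/
structure HasGeometricDrift (P : Kernel α α) (V : α → ℝ) (γ K : ℝ) : Prop where
  measurable : Measurable V
  nonneg : ∀ x, 0 ≤ V x
  rate_nonneg : 0 ≤ γ
  rate_lt_one : γ < 1
  const_nonneg : 0 ≤ K
  lintegral_le : ∀ x, ∫⁻ y, ENNReal.ofReal (V y) ∂P x ≤ ENNReal.ofReal (γ * V x + K)

theorem integrable_of_lintegral_ofReal_le {μ : Measure α} (hV : Measurable V) (hV0 : ∀ x, 0 ≤ V x)
    {b : ℝ} (h : ∫⁻ x, ENNReal.ofReal (V x) ∂μ ≤ ENNReal.ofReal b) : Integrable V μ := by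
  refine ⟨hV.aestronglyMeasurable, ?_⟩
  rw [hasFiniteIntegral_iff_ofReal (Eventually.of_forall hV0)]
  exact h.trans_lt ENNReal.ofReal_lt_top

theorem exists_contraction_constants {R a : ℝ} (hγ : γ < 1) (hK : 0 ≤ K) (hR : 2 * K < (1 - γ) * R)
    (ha : 0 < a) : ∃ β r : ℝ, 0 < β ∧ 0 < r ∧ r < 1 ∧ γ ≤ r ∧ 1 - a / 2 ≤ r ∧ 2 * β * K ≤ a ∧
      2 + 2 * β * K + β * γ * R ≤ r * (2 + β * R) := by
  have hR0 : 0 < R := pos_of_mul_pos_right (hR.trans_le' (by linarith)) (by linarith)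
  set β := a / (2 * (K + 1)) with hβdef
  have hβ0 : 0 < β := by positivity
  have hβK : 2 * β * (K + 1) = a := by rw [hβdef]; field_simp
  have hden : 0 < 2 + β * R := by positivity
  set ρ := (2 + 2 * β * K + β * γ * R) / (2 + β * R)
  have hρ : ρ < 1 := by
    rw [div_lt_one hden]
    nlinarith
  refine ⟨β, max (max γ (1 - a / 2)) (max (1 / 2) ρ), hβ0, ?_, ?_, ?_, ?_, by nlinarith, ?_⟩
  · exact lt_max_of_lt_right (lt_max_of_lt_left one_half_pos)
  · exact max_lt (max_lt hγ (by linarith)) (max_lt one_half_lt_one hρ)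
  · exact le_max_of_le_left (le_max_left _ _)
  · exact le_max_of_le_left (le_max_right _ _)
  · rw [← div_le_iff₀ hden]
    exact le_max_of_le_right (le_max_right _ _)

namespace HasGeometricDrift

variable (hV : HasGeometricDrift P V γ K)
include hV

theorem integrable (x : α) : Integrable V (P x) :=
  integrable_of_lintegral_ofReal_le hV.measurable hV.nonneg (hV.lintegral_le x)

theorem integral_le (x : α) : ∫ y, V y ∂P x ≤ γ * V x + K := by
  rw [integral_eq_lintegral_of_nonneg_ae (Eventually.of_forall hV.nonneg)
    hV.measurable.aestronglyMeasurable]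
  exact ENNReal.toReal_le_of_le_ofReal
    (add_nonneg (mul_nonneg hV.rate_nonneg (hV.nonneg x)) hV.const_nonneg) (hV.lintegral_le x)

variable [IsMarkovKernel P]

theorem integrable_one_add_mul (β : ℝ) (x : α) : Integrable (fun y => 1 + β * V y) (P x) :=
  (integrable_const _).add ((hV.integrable x).const_mul β)

theorem integral_one_add_mul_le {β : ℝ} (hβ : 0 ≤ β) (x : α) :
    ∫ y, (1 + β * V y) ∂P x ≤ 1 + β * (γ * V x + K) := by
  rw [integral_add (integrable_const _) ((hV.integrable x).const_mul β), integral_const_mul]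
  simpa using mul_le_mul_of_nonneg_left (hV.integral_le x) hβ

theorem lintegral_pow_le (n : ℕ) (x : α) :
    ∫⁻ y, ENNReal.ofReal (V y) ∂((P ^ n) x) ≤ ENNReal.ofReal (V x + K / (1 - γ)) := by
  have hγ : 0 < 1 - γ := sub_pos.2 hV.rate_lt_one
  have hKγ : 0 ≤ K / (1 - γ) := div_nonneg hV.const_nonneg hγ.le
  have hV_meas := hV.measurable.ennreal_ofReal
  induction n with
  | zero =>
    change ∫⁻ y, ENNReal.ofReal (V y) ∂(Kernel.id x) ≤ _
    rw [Kernel.id_apply, lintegral_dirac' _ hV_meas]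
    exact ENNReal.ofReal_le_ofReal (le_add_of_nonneg_right hKγ)
  | succ n ih =>
    have pow_eq : P ^ (n + 1) = P ∘ₖ (P ^ n) := by rw [add_comm, Kernel.pow_add, pow_one]
    rw [pow_eq, Kernel.lintegral_comp _ _ _ hV_meas]
    calc ∫⁻ y, ∫⁻ z, ENNReal.ofReal (V z) ∂P y ∂(P ^ n) x
        ≤ ∫⁻ y, (ENNReal.ofReal γ * ENNReal.ofReal (V y) + ENNReal.ofReal K) ∂(P ^ n) x := by
          refine lintegral_mono fun y => (hV.lintegral_le y).trans_eq ?_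
          rw [ENNReal.ofReal_add (mul_nonneg hV.rate_nonneg (hV.nonneg y)) hV.const_nonneg,
            ENNReal.ofReal_mul hV.rate_nonneg]
      _ = ENNReal.ofReal γ * ∫⁻ y, ENNReal.ofReal (V y) ∂(P ^ n) x + ENNReal.ofReal K := by
          rw [lintegral_add_right _ measurable_const, lintegral_const_mul _ hV_meas]
          simp
      _ ≤ ENNReal.ofReal γ * ENNReal.ofReal (V x + K / (1 - γ)) + ENNReal.ofReal K := by gcongr
      _ = ENNReal.ofReal (γ * (V x + K / (1 - γ)) + K) := by
          rw [ENNReal.ofReal_add (mul_nonneg hV.rate_nonneg (add_nonneg (hV.nonneg x) hKγ))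
            hV.const_nonneg, ENNReal.ofReal_mul hV.rate_nonneg]
      _ ≤ ENNReal.ofReal (V x + K / (1 - γ)) := by
          refine ENNReal.ofReal_le_ofReal ?_
          linarith [mul_div_cancel₀ K hγ.ne', mul_nonneg hγ.le (hV.nonneg x)]

theorem contractsOscillation {R β r : ℝ} {η : Measure α} [IsFiniteMeasure η]
    (hη : ∀ x, V x ≤ R → η ≤ P x) (hβ : 0 ≤ β) (hγr : γ ≤ r) (hηr : 1 - η.real univ / 2 ≤ r)
    (hβK : 2 * β * K ≤ η.real univ) (hR : 2 + 2 * β * K + β * γ * R ≤ r * (2 + β * R)) :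
    ContractsOscillation P (fun x => 1 + β * V x) r := by
  intro φ c hc hφ h x y
  have bound (θ : Measure α) (hx : θ ≤ P x) (hy : θ ≤ P y) :
      |∫ z, φ z ∂P x - ∫ z, φ z ∂P y| ≤ c * (2 + 2 * β * K + β * γ * (V x + V y)
        - 2 * ∫ z, (1 + β * V z) ∂θ) := by
    have := abs_integral_sub_integral_le_of_minorant hx hy (hφ x) (hφ y)
      ((hV.integrable_one_add_mul β x).const_mul c) ((hV.integrable_one_add_mul β y).const_mul c)
      (fun z z' => (h z z').trans_eq (mul_add _ _ _))
    simp only [integral_const_mul] at this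
    linarith [mul_le_mul_of_nonneg_left (hV.integral_one_add_mul_le hβ x) hc,
      mul_le_mul_of_nonneg_left (hV.integral_one_add_mul_le hβ y) hc]
  rw [mul_assoc]
  rcases le_total R (V x + V y) with far | near
  · refine (bound 0 (Measure.zero_le _) (Measure.zero_le _)).trans
      (mul_le_mul_of_nonneg_left ?_ hc)
    rw [integral_zero_measure]
    linarith [mul_nonneg (mul_nonneg hβ (sub_nonneg.2 hγr)) (sub_nonneg.2 far)]
  · have hx := hη x (by linarith [hV.nonneg y])
    refine (bound η hx (hη y (by linarith [hV.nonneg x]))).trans (mul_le_mul_of_nonneg_left ?_ hc)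
    have mass_le : η.real univ ≤ ∫ z, (1 + β * V z) ∂η := by
      rw [integral_add (integrable_const _) (((hV.integrable x).mono_measure hx).const_mul β),
        integral_const_mul]
      simpa using mul_nonneg hβ (integral_nonneg hV.nonneg)
    linarith [mul_nonneg (mul_nonneg hβ (sub_nonneg.2 hγr))
      (add_nonneg (hV.nonneg x) (hV.nonneg y))]

theorem exists_invariant_tvNorm_le [Nonempty α] {R : ℝ} (hR : 2 * K < (1 - γ) * R)
    {η : Measure α} [IsFiniteMeasure η] [NeZero η] (hη : ∀ x, V x ≤ R → η ≤ P x) :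
    ∃ (π : Measure α) (_ : IsProbabilityMeasure π), P.Invariant π ∧ Integrable V π ∧
      ∃ C lam : ℝ, 0 < C ∧ 0 < lam ∧
        ∀ (n : ℕ) (x : α), tvNorm ((P ^ n) x) π ≤ C * (1 + V x) * Real.exp (-lam * n) := by
  obtain ⟨β, r, hβ, hr0, hr1, hγr, hηr, hβK, hRr⟩ :=
    exists_contraction_constants hV.rate_lt_one hV.const_nonneg hR (measureReal_univ_pos (μ := η))
  set w : α → ℝ := fun x => 1 + β * V x with hw
  obtain ⟨π, hπ, rate⟩ :=
    (hV.contractsOscillation hη hβ.le hγr hηr hβK hRr).exists_abs_pow_sub_le hr0.le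
      (fun x => le_add_of_nonneg_right (mul_nonneg hβ.le (hV.nonneg x)))
      (hV.integrable_one_add_mul β) hr1
  obtain ⟨x₀⟩ := ‹Nonempty α›
  have setwise (A) (hA : MeasurableSet A) : Tendsto (fun n => (P ^ n) x₀ A) atTop (𝓝 (π A)) := by
    rw [← ENNReal.tendsto_toReal_iff (fun n => measure_ne_top _ _) (measure_ne_top _ _),
      tendsto_iff_norm_sub_tendsto_zero]
    refine squeeze_zero (fun _ => norm_nonneg _) (fun n => rate n x₀ A hA) ?_
    simpa using ((tendsto_pow_atTop_nhds_zero_of_lt_one hr0.le hr1).const_mul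
      (w x₀ + ∫ y, w y ∂P x₀)).div_const (1 - r)
  have : 0 < 1 - r := sub_pos.2 hr1
  have hK := hV.const_nonneg
  refine ⟨π, hπ, invariant_of_tendsto_pow_apply setwise,
    integrable_of_lintegral_ofReal_le hV.measurable hV.nonneg (lintegral_le_of_tendsto_measure
      setwise (fun n => hV.lintegral_pow_le n x₀) tendsto_const_nhds),
    2 * (2 + 2 * β + β * K) / (1 - r), -Real.log r, by positivity,
    neg_pos.2 (Real.log_neg hr0 hr1), fun n x => ?_⟩
  have weight_le : w x + ∫ y, w y ∂P x ≤ (2 + 2 * β + β * K) * (1 + V x) := by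
    have := mul_nonneg hβ.le (mul_nonneg (sub_nonneg.2 hV.rate_lt_one.le) (hV.nonneg x))
    have := mul_nonneg (mul_nonneg hβ.le hK) (hV.nonneg x)
    simp only [hw]
    linarith [hV.nonneg x, hV.integral_one_add_mul_le hβ.le x]
  calc tvNorm ((P ^ n) x) π
      ≤ 2 * ((w x + ∫ y, w y ∂P x) * r ^ n / (1 - r)) :=
        tvNorm_le_of_forall_abs_sub_le (rate n x)
    _ ≤ 2 * ((2 + 2 * β + β * K) * (1 + V x) * r ^ n / (1 - r)) := by gcongr
    _ = 2 * (2 + 2 * β + β * K) / (1 - r) * (1 + V x) * Real.exp (-(-Real.log r) * n) := by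
        rw [neg_neg, mul_comm (Real.log r), Real.exp_nat_mul, Real.exp_log hr0]
        ring

end HasGeometricDrift

end Harris

section SkewGaussian

theorem coe_toNNReal_eq_ofReal (q : unitInterval) :
    ((unitInterval.toNNReal q : NNReal) : ENNReal) = ENNReal.ofReal (q : ℝ) := by
  rw [ENNReal.ofReal, ENNReal.coe_inj]
  ext
  simp [q.2.1]

theorem lintegral_bernoulliMeasure {α : Type*} [MeasurableSpace α] (x y : α) (q : unitInterval)
    {f : α → ENNReal} (hf : Measurable f) :
    ∫⁻ z, f z ∂bernoulliMeasure x y q = ENNReal.ofReal q * f x + ENNReal.ofReal (1 - q) * f y := by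
  simp only [bernoulliMeasure_def, lintegral_add_measure, lintegral_smul_measure,
    lintegral_dirac' _ hf, ENNReal.smul_def, coe_toNNReal_eq_ofReal, smul_eq_mul,
    unitInterval.coe_symm_eq]

/-- One step of the one-dimensional skew-symmetric scheme: the law of `u + s * b * t`, where `t` is
a standard Gaussian and, given `t`, the sign `b` equals `1` with probability `r t` and `-1`
otherwise. -/
noncomputable def skewGaussian (u s : ℝ) (r : ℝ → unitInterval) : Measure ℝ :=
  (gaussianReal 0 1).bind fun t => bernoulliMeasure (u + s * t) (u - s * t) (r t)

variable {u s : ℝ} {r : ℝ → unitInterval}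

theorem measurable_bernoulliMeasure_step (u s : ℝ) (hr : Measurable r) :
    Measurable fun t => bernoulliMeasure (u + s * t) (u - s * t) (r t) := by
  refine Measure.measurable_of_measurable_coe _ fun A hA => ?_
  have eval_indicator (μ : Measure ℝ) : μ A = ∫⁻ y, A.indicator 1 y ∂μ := by
    rw [lintegral_indicator_one hA]
  have : Measurable (A.indicator (1 : ℝ → ENNReal)) := measurable_one.indicator hA
  simp only [eval_indicator, lintegral_bernoulliMeasure _ _ _ this]
  fun_prop

theorem lintegral_skewGaussian (u s : ℝ) (hr : Measurable r) {f : ℝ → ENNReal}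
    (hf : Measurable f) :
    ∫⁻ y, f y ∂skewGaussian u s r = ∫⁻ t, (ENNReal.ofReal (r t) * f (u + s * t)
      + ENNReal.ofReal (1 - r t) * f (u - s * t)) ∂gaussianReal 0 1 := by
  rw [skewGaussian, Measure.lintegral_bind (measurable_bernoulliMeasure_step u s hr).aemeasurable
    hf.aemeasurable]
  simp only [lintegral_bernoulliMeasure _ _ _ hf]

theorem isProbabilityMeasure_skewGaussian (u s : ℝ) (hr : Measurable r) :
    IsProbabilityMeasure (skewGaussian u s r) :=
  isProbabilityMeasure_bind (measurable_bernoulliMeasure_step u s hr).aemeasurable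
    (Eventually.of_forall fun _ => inferInstance)

theorem map_gaussianReal_affine (m s : ℝ) :
    (gaussianReal 0 1).map (fun t => m + s * t)
      = gaussianReal m (NNReal.mk (s ^ 2) (sq_nonneg s)) := by
  have map_mul := gaussianReal_map_const_mul (μ := 0) (v := 1) s
  have map_add := gaussianReal_map_const_add (μ := s * 0)
    (v := NNReal.mk (s ^ 2) (sq_nonneg s) * 1) m
  rw [← map_mul, Measure.map_map (by fun_prop) (by fun_prop)] at map_add
  simpa [Function.comp_def] using map_add

/-- A lower bound on `[-1, 1]` for the Gaussian densities with mean in `[-R, R]` and standard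
deviation in `[s₀, S]`. -/
noncomputable def gaussianLowerBound (s₀ S R : ℝ) : ℝ :=
  (√(2 * Real.pi * S ^ 2))⁻¹ * Real.exp (-((R + 1) ^ 2 / (2 * s₀ ^ 2)))

theorem gaussianLowerBound_pos {s₀ S R : ℝ} (hS : 0 < S) : 0 < gaussianLowerBound s₀ S R := by
  unfold gaussianLowerBound
  positivity

theorem gaussianLowerBound_le_gaussianPDFReal {m s s₀ S R y : ℝ} (hs₀ : 0 < s₀) (hs : s₀ ≤ s)
    (hsS : s ≤ S) (hm : |m| ≤ R) (hy : y ∈ Icc (-1 : ℝ) 1) :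
    gaussianLowerBound s₀ S R ≤ gaussianPDFReal m (NNReal.mk (s ^ 2) (sq_nonneg s)) y := by
  have hs0 : 0 < s := hs₀.trans_le hs
  have sq_le : (y - m) ^ 2 ≤ (R + 1) ^ 2 := by
    have := abs_le.1 hm
    exact sq_le_sq' (by linarith [hy.1]) (by linarith [hy.2])
  rw [gaussianPDFReal, NNReal.coe_mk, neg_div, gaussianLowerBound]
  gcongr

theorem smul_volume_restrict_le_map_gaussianReal {m s s₀ S R : ℝ} (hs₀ : 0 < s₀) (hs : s₀ ≤ s)
    (hsS : s ≤ S) (hm : |m| ≤ R) :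
    ENNReal.ofReal (gaussianLowerBound s₀ S R) • volume.restrict (Icc (-1 : ℝ) 1)
      ≤ ((gaussianReal 0 1).map fun t => m + s * t).restrict (Icc (-1) 1) := by
  have hv : NNReal.mk (s ^ 2) (sq_nonneg s) ≠ 0 :=
    (show 0 < NNReal.mk (s ^ 2) (sq_nonneg s) from pow_pos (hs₀.trans_le hs) 2).ne'
  rw [map_gaussianReal_affine, gaussianReal_of_var_ne_zero _ hv,
    restrict_withDensity measurableSet_Icc, ← withDensity_const]
  refine withDensity_mono ?_
  filter_upwards [ae_restrict_mem measurableSet_Icc] with y hy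
  exact ENNReal.ofReal_le_ofReal (gaussianLowerBound_le_gaussianPDFReal hs₀ hs hsS hm hy)

theorem smul_volume_restrict_le_skewGaussian (hr : Measurable r) {s₀ S R ε : ℝ} (hs₀ : 0 < s₀)
    (hs : s₀ ≤ s) (hsS : s ≤ S) (hu : |u| ≤ R)
    (hε : ∀ t ∈ Icc (-((R + 1) / s₀)) ((R + 1) / s₀), ε ≤ r t) :
    (ENNReal.ofReal ε * ENNReal.ofReal (gaussianLowerBound s₀ S R)) •
      volume.restrict (Icc (-1 : ℝ) 1) ≤ skewGaussian u s r := by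
  have noise_mem {t : ℝ} (ht : u + s * t ∈ Icc (-1) 1) :
      t ∈ Icc (-((R + 1) / s₀)) ((R + 1) / s₀) := by
    rw [mem_Icc, ← abs_le] at ht ⊢
    rw [le_div_iff₀' hs₀]
    calc s₀ * |t| ≤ s * |t| := by gcongr
      _ = |(u + s * t) - u| := by rw [add_sub_cancel_left, abs_mul, abs_of_pos (hs₀.trans_le hs)]
      _ ≤ R + 1 := by linarith [abs_sub (u + s * t) u]
  rw [mul_smul]
  refine (_root_.smul_le_smul_left _
    (smul_volume_restrict_le_map_gaussianReal hs₀ hs hsS hu)).trans ?_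
  refine Measure.le_iff.2 fun A hA => ?_
  have step_measurable : Measurable fun t => u + s * t := by fun_prop
  have hAI : MeasurableSet (A ∩ Icc (-1) 1) := hA.inter measurableSet_Icc
  rw [Measure.smul_apply, Measure.restrict_apply hA, Measure.map_apply step_measurable hAI,
    smul_eq_mul, ← setLIntegral_const, ← lintegral_indicator (step_measurable hAI),
    ← lintegral_indicator_one hA, lintegral_skewGaussian u s hr (measurable_one.indicator hA)]
  refine lintegral_mono (indicator_le' (fun t ht => ?_) fun _ _ => zero_le)
  rw [indicator_of_mem ht.1, Pi.one_apply, mul_one]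
  exact le_add_right (ENNReal.ofReal_le_ofReal (hε t (noise_mem ht.2)))

end SkewGaussian

section CoshMean

theorem mix_cosh_eq (h a b : ℝ) :
    h * Real.cosh (a + b) + (1 - h) * Real.cosh (a - b)
      = Real.cosh a * Real.cosh b + (2 * h - 1) * (Real.sinh a * Real.sinh b) := by
  rw [Real.cosh_add, Real.cosh_sub]
  ring

/-- The probability that the increment `b * t`, with `b = 1` of probability `h` and `b = -1`
otherwise, has the sign of `u`, that is, points away from the origin. -/
noncomputable def outwardProb (h u t : ℝ) : ℝ := if 0 ≤ u * t then h else 1 - h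

theorem outwardProb_mem_Icc {h : ℝ} (hh : h ∈ Icc (0 : ℝ) 1) (u t : ℝ) :
    outwardProb h u t ∈ Icc (0 : ℝ) 1 := by
  obtain ⟨h0, h1⟩ := hh
  unfold outwardProb
  split_ifs <;> constructor <;> linarith

theorem sinh_mul_sinh_eq_ite (u v : ℝ) : Real.sinh u * Real.sinh v
    = (if 0 ≤ u * v then 1 else -1) * (Real.sinh |u| * Real.sinh |v|) := by
  rw [← Real.abs_sinh, ← Real.abs_sinh, ← abs_mul]
  split_ifs with h
  · rw [one_mul, abs_of_nonneg]
    rcases mul_nonneg_iff.1 h with ⟨hu, hv⟩ | ⟨hu, hv⟩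
    · exact mul_nonneg (Real.sinh_nonneg_iff.2 hu) (Real.sinh_nonneg_iff.2 hv)
    · exact mul_nonneg_of_nonpos_of_nonpos (Real.sinh_nonpos_iff.2 hu) (Real.sinh_nonpos_iff.2 hv)
  · rw [neg_one_mul, abs_of_nonpos, neg_neg]
    rcases mul_neg_iff.1 (not_le.1 h) with ⟨hu, hv⟩ | ⟨hu, hv⟩
    · exact mul_nonpos_of_nonneg_of_nonpos (Real.sinh_nonneg_iff.2 hu.le)
        (Real.sinh_nonpos_iff.2 hv.le)
    · exact mul_nonpos_of_nonpos_of_nonneg (Real.sinh_nonpos_iff.2 hu.le)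
        (Real.sinh_nonneg_iff.2 hv.le)

theorem mix_cosh_le {h s : ℝ} (hh : h ∈ Icc (0 : ℝ) 1) (hs : 0 < s) (u t : ℝ) :
    h * Real.cosh (u + s * t) + (1 - h) * Real.cosh (u - s * t)
      ≤ Real.cosh u * (Real.exp (-(s * |t|)) + 2 * (outwardProb h u t * Real.sinh (s * |t|)))
        + Real.sinh (s * |t|) := by
  obtain ⟨w0, w1⟩ := outwardProb_mem_Icc hh u t
  set w := outwardProb h u t with hw
  set T := s * |t|
  have sinh_T : 0 ≤ Real.sinh T := Real.sinh_nonneg_iff.2 (by positivity)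
  have mix_eq : h * Real.cosh (u + s * t) + (1 - h) * Real.cosh (u - s * t)
      = Real.cosh u * Real.cosh T + (2 * w - 1) * (Real.sinh |u| * Real.sinh T) := by
    have abs_st : |s * t| = T := by rw [abs_mul, abs_of_pos hs]
    have sign_iff : 0 ≤ u * (s * t) ↔ 0 ≤ u * t := by
      rw [mul_left_comm, mul_nonneg_iff_of_pos_left hs]
    rw [mix_cosh_eq, sinh_mul_sinh_eq_ite, abs_st, ← Real.cosh_abs (s * t), abs_st, hw,
      outwardProb]
    simp only [sign_iff]
    split_ifs <;> ring
  have sinh_le_cosh : Real.sinh |u| ≤ Real.cosh u := Real.cosh_abs u ▸ (Real.sinh_lt_cosh |u|).le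
  have cosh_sub_one_le : Real.cosh u - 1 ≤ Real.sinh |u| := by
    have : Real.exp (-|u|) ≤ 1 := Real.exp_le_one_iff.2 (neg_nonpos.2 (abs_nonneg u))
    linarith [Real.cosh_sub_sinh |u|, Real.cosh_abs u]
  have drift_le : (2 * w - 1) * Real.sinh |u| ≤ (2 * w - 1) * Real.cosh u + 1 := by
    rcases le_total 0 (2 * w - 1) with h' | h'
    · linarith [mul_le_mul_of_nonneg_left sinh_le_cosh h']
    · linarith [mul_le_mul_of_nonpos_left cosh_sub_one_le h']
  rw [mix_eq, ← Real.cosh_sub_sinh T]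
  linarith [mul_le_mul_of_nonneg_right drift_le sinh_T]

/-- Pointwise in the noise `t`, the factor by which a one-dimensional skew-symmetric step of scale
between `s₀` and `S` shrinks `cosh`, up to an additive term, provided the outward probability is at
most `ε` for all `|t| ≥ ε`. -/
noncomputable def damping (s₀ S ε t : ℝ) : ℝ :=
  Real.exp (-(s₀ * |t|)) + 2 * ε * Real.sinh (S * |t|) + 2 * Real.sinh (S * ε)

theorem mix_cosh_le_damping {h s₀ s S ε u t : ℝ} (hh : h ∈ Icc (0 : ℝ) 1) (hs₀ : 0 < s₀)
    (hs : s₀ ≤ s) (hsS : s ≤ S) (hε : 0 ≤ ε) (hw : ε ≤ |t| → outwardProb h u t ≤ ε) :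
    h * Real.cosh (u + s * t) + (1 - h) * Real.cosh (u - s * t)
      ≤ damping s₀ S ε t * Real.cosh u + Real.sinh (S * |t|) := by
  have hs0 : 0 < s := hs₀.trans_le hs
  have hS : 0 < S := hs0.trans_le hsS
  have w1 := (outwardProb_mem_Icc hh u t).2
  have exp_le : Real.exp (-(s * |t|)) ≤ Real.exp (-(s₀ * |t|)) := by gcongr
  have sinh_le : Real.sinh (s * |t|) ≤ Real.sinh (S * |t|) := Real.sinh_le_sinh.2 (by gcongr)
  have sinh_s : 0 ≤ Real.sinh (s * |t|) := Real.sinh_nonneg_iff.2 (by positivity)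
  have sinh_ε : 0 ≤ Real.sinh (S * ε) := Real.sinh_nonneg_iff.2 (by positivity)
  have outward_le : outwardProb h u t * Real.sinh (s * |t|)
      ≤ ε * Real.sinh (S * |t|) + Real.sinh (S * ε) := by
    rcases le_total ε |t| with large | small
    · linarith [mul_le_mul (hw large) sinh_le sinh_s hε]
    · have : Real.sinh (s * |t|) ≤ Real.sinh (S * ε) := Real.sinh_le_sinh.2 (by gcongr)
      linarith [mul_le_mul w1 this sinh_s zero_le_one, mul_nonneg hε (sinh_s.trans sinh_le)]
  refine (mix_cosh_le hh hs0 u t).trans (add_le_add ?_ sinh_le)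
  rw [mul_comm, damping]
  exact mul_le_mul_of_nonneg_right (by linarith) (Real.cosh_pos u).le

end CoshMean

section GaussianDamping

theorem integrable_exp_mul_abs_gaussianReal (c : ℝ) :
    Integrable (fun t => Real.exp (c * |t|)) (gaussianReal 0 1) :=
  integrable_exp_mul_abs (integrable_exp_mul_gaussianReal c) (integrable_exp_mul_gaussianReal (-c))

theorem integrable_sinh_mul_abs_gaussianReal (S : ℝ) :
    Integrable (fun t => Real.sinh (S * |t|)) (gaussianReal 0 1) := by
  simp only [Real.sinh_eq, ← neg_mul]
  exact ((integrable_exp_mul_abs_gaussianReal S).sub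
    (integrable_exp_mul_abs_gaussianReal (-S))).div_const 2

theorem integrable_damping (s₀ S ε : ℝ) : Integrable (damping s₀ S ε) (gaussianReal 0 1) := by
  have := integrable_exp_mul_abs_gaussianReal (-s₀)
  simp only [neg_mul] at this
  exact (this.add ((integrable_sinh_mul_abs_gaussianReal S).const_mul _)).add (integrable_const _)

theorem integral_exp_neg_mul_abs_gaussianReal_lt_one {s₀ : ℝ} (hs₀ : 0 < s₀) :
    ∫ t, Real.exp (-(s₀ * |t|)) ∂gaussianReal 0 1 < 1 := by
  have integrable_exp : Integrable (fun t => Real.exp (-(s₀ * |t|))) (gaussianReal 0 1) := by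
    simpa only [neg_mul] using integrable_exp_mul_abs_gaussianReal (-s₀)
  have gap_nonneg (t : ℝ) : 0 ≤ 1 - Real.exp (-(s₀ * |t|)) :=
    sub_nonneg.2 (Real.exp_le_one_iff.2 (neg_nonpos.2 (by positivity)))
  have gap_support : Function.support (fun t => 1 - Real.exp (-(s₀ * |t|))) = {0}ᶜ := by
    ext t
    simp [sub_eq_zero, @eq_comm _ (1 : ℝ), hs₀.ne']
  have gap_pos : 0 < ∫ t, (1 - Real.exp (-(s₀ * |t|))) ∂gaussianReal 0 1 := by
    have := nullSingletonClass_gaussianReal (μ := 0) (v := 1) one_ne_zero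
    rw [integral_pos_iff_support_of_nonneg gap_nonneg ((integrable_const 1).sub integrable_exp),
      gap_support, prob_compl_eq_one_sub (measurableSet_singleton 0), measure_singleton]
    simp
  rw [integral_sub (integrable_const 1) integrable_exp] at gap_pos
  simpa using gap_pos

theorem exists_integral_damping_lt_one {s₀ : ℝ} (hs₀ : 0 < s₀) (S : ℝ) :
    ∃ ε > 0, ∫ t, damping s₀ S ε t ∂gaussianReal 0 1 < 1 := by
  have integrable_exp : Integrable (fun t => Real.exp (-(s₀ * |t|))) (gaussianReal 0 1) := by
    simpa only [neg_mul] using integrable_exp_mul_abs_gaussianReal (-s₀)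
  have integral_eq (ε : ℝ) : ∫ t, damping s₀ S ε t ∂gaussianReal 0 1
      = ∫ t, Real.exp (-(s₀ * |t|)) ∂gaussianReal 0 1
        + 2 * ε * ∫ t, Real.sinh (S * |t|) ∂gaussianReal 0 1 + 2 * Real.sinh (S * ε) := by
    have integrable_sinh := (integrable_sinh_mul_abs_gaussianReal S).const_mul (2 * ε)
    simp only [damping]
    rw [integral_add (by exact integrable_exp.add integrable_sinh) (integrable_const _),
      integral_add integrable_exp integrable_sinh, integral_const_mul]
    simp
  simp only [integral_eq]
  have cont : Continuous fun ε => ∫ t, Real.exp (-(s₀ * |t|)) ∂gaussianReal 0 1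
        + 2 * ε * ∫ t, Real.sinh (S * |t|) ∂gaussianReal 0 1 + 2 * Real.sinh (S * ε) := by
    fun_prop
  have at_zero := integral_exp_neg_mul_abs_gaussianReal_lt_one hs₀
  have eventually_lt := (cont.tendsto 0).eventually (gt_mem_nhds (by simpa using at_zero))
  have eventually_pos : ∀ᶠ ε in 𝓝[>] (0 : ℝ), 0 < ε := self_mem_nhdsWithin
  exact (eventually_pos.and (eventually_lt.filter_mono nhdsWithin_le_nhds)).exists

theorem lintegral_cosh_skewGaussian_le {u s₀ s S ε : ℝ} {r : ℝ → unitInterval} (hr : Measurable r)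
    (hs₀ : 0 < s₀) (hs : s₀ ≤ s) (hsS : s ≤ S) (hε : 0 ≤ ε)
    (hw : ∀ t, ε ≤ |t| → outwardProb (r t) u t ≤ ε) :
    ∫⁻ y, ENNReal.ofReal (Real.cosh y) ∂skewGaussian u s r
      ≤ ENNReal.ofReal ((∫ t, damping s₀ S ε t ∂gaussianReal 0 1) * Real.cosh u
        + ∫ t, Real.sinh (S * |t|) ∂gaussianReal 0 1) := by
  have integrable_main := (integrable_damping s₀ S ε).mul_const (Real.cosh u)
  have integrable_sinh := integrable_sinh_mul_abs_gaussianReal S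
  have mix_nonneg (t : ℝ) :
      0 ≤ r t * Real.cosh (u + s * t) + (1 - r t) * Real.cosh (u - s * t) :=
    add_nonneg (mul_nonneg (r t).2.1 (Real.cosh_pos _).le)
      (mul_nonneg (sub_nonneg.2 (r t).2.2) (Real.cosh_pos _).le)
  have mix_le (t : ℝ) := mix_cosh_le_damping (r t).2 hs₀ hs hsS hε (hw t)
  rw [lintegral_skewGaussian u s hr (by fun_prop)]
  calc ∫⁻ t, (ENNReal.ofReal (r t) * ENNReal.ofReal (Real.cosh (u + s * t))
        + ENNReal.ofReal (1 - r t) * ENNReal.ofReal (Real.cosh (u - s * t))) ∂gaussianReal 0 1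
      ≤ ∫⁻ t, ENNReal.ofReal (damping s₀ S ε t * Real.cosh u + Real.sinh (S * |t|))
          ∂gaussianReal 0 1 := by
        refine lintegral_mono fun t => ?_
        rw [← ENNReal.ofReal_mul (r t).2.1, ← ENNReal.ofReal_mul (sub_nonneg.2 (r t).2.2),
          ← ENNReal.ofReal_add (mul_nonneg (r t).2.1 (Real.cosh_pos _).le)
            (mul_nonneg (sub_nonneg.2 (r t).2.2) (Real.cosh_pos _).le)]
        exact ENNReal.ofReal_le_ofReal (mix_le t)
    _ = _ := by
        rw [← ofReal_integral_eq_lintegral_ofReal (by exact integrable_main.add integrable_sinh)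
          (Eventually.of_forall fun t => (mix_nonneg t).trans (mix_le t)),
          integral_add integrable_main integrable_sinh, integral_mul_const]

end GaussianDamping

section ProductMeasure

variable {ι : Type*} [Fintype ι] {X Y : ι → Type*} [∀ i, MeasurableSpace (X i)]
  [∀ i, MeasurableSpace (Y i)]

theorem measure_pi_mono {μ ν : ∀ i, Measure (X i)} [∀ i, SigmaFinite (μ i)]
    (h : ∀ i, μ i ≤ ν i) : Measure.pi μ ≤ Measure.pi ν := by
  refine Measure.le_iff.2 fun A hA => ?_
  rw [Measure.pi_def (μ := ν), toMeasure_apply _ _ hA]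
  have outer_le :
      (Measure.pi μ).toOuterMeasure ≤ OuterMeasure.pi fun i => (ν i).toOuterMeasure := by
    refine OuterMeasure.le_pi.2 fun s _ => ?_
    change Measure.pi μ (univ.pi s) ≤ _
    rw [Measure.pi_pi]
    exact Finset.prod_le_prod' fun i _ => h i (s i)
  exact outer_le A

theorem lintegral_pi_prod (μ : ∀ i, Measure (X i)) [∀ i, IsProbabilityMeasure (μ i)]
    {f : ∀ i, X i → ENNReal} (hf : ∀ i, Measurable (f i)) :
    ∫⁻ x, ∏ i, f i (x i) ∂Measure.pi μ = ∏ i, ∫⁻ t, f i t ∂μ i := by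
  have indep : iIndepFun (fun i (x : ∀ i, X i) => f i (x i)) (Measure.pi μ) :=
    iIndepFun_pi fun i => (hf i).aemeasurable
  rw [lintegral_prod_eq_prod_lintegral_of_indepFun Finset.univ _ indep
    fun i => (hf i).comp (measurable_pi_apply i)]
  exact Finset.prod_congr rfl fun i _ => (measurePreserving_eval μ i).lintegral_comp (hf i)

theorem measurable_measure_pi {κ : ∀ i, X i → Measure (Y i)}
    [∀ i t, IsProbabilityMeasure (κ i t)] (hκ : ∀ i, Measurable (κ i)) :
    Measurable fun x : ∀ i, X i => Measure.pi fun i => κ i (x i) := by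
  refine Measurable.measure_of_isPiSystem_of_isProbabilityMeasure generateFrom_pi.symm
    isPiSystem_pi ?_
  rintro _ ⟨A, hA, rfl⟩
  simp only [Measure.pi_pi]
  exact Finset.measurable_prod _ fun i _ =>
    (Measure.measurable_coe (hA i (mem_univ i))).comp ((hκ i).comp (measurable_pi_apply i))

theorem bind_pi_pi (μ : ∀ i, Measure (X i)) [∀ i, IsProbabilityMeasure (μ i)]
    {κ : ∀ i, X i → Measure (Y i)} [∀ i t, IsProbabilityMeasure (κ i t)]
    (hκ : ∀ i, Measurable (κ i)) :
    (Measure.pi μ).bind (fun x => Measure.pi fun i => κ i (x i))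
      = Measure.pi fun i => (μ i).bind (κ i) := by
  have (i : ι) : IsProbabilityMeasure ((μ i).bind (κ i)) :=
    isProbabilityMeasure_bind (hκ i).aemeasurable (Eventually.of_forall fun _ => inferInstance)
  refine (Measure.pi_eq fun A hA => ?_).symm
  rw [Measure.bind_apply (MeasurableSet.univ_pi hA) (measurable_measure_pi hκ).aemeasurable]
  simp only [Measure.pi_pi, Measure.bind_apply (hA _) (hκ _).aemeasurable]
  exact lintegral_pi_prod μ fun i => (Measure.measurable_coe (hA i)).comp (hκ i)

end ProductMeasure

section Kernel

variable {d : ℕ} {Δt : ℝ} {σ : EuclideanSpace ℝ (Fin d) → Matrix (Fin d) (Fin d) ℝ}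
  {p : Fin d → EuclideanSpace ℝ (Fin d) → EuclideanSpace ℝ (Fin d) → unitInterval}
  {r : Fin d → EuclideanSpace ℝ (Fin d) → ℝ → unitInterval}

theorem exists_coordinate_prob {g : Fin d → EuclideanSpace ℝ (Fin d) → ℝ → ℝ}
    (hg : ∀ i x ν, (p i x ν : ℝ) = g i x (ν i)) :
    ∃ r : Fin d → EuclideanSpace ℝ (Fin d) → ℝ → unitInterval,
      (∀ i x ν, p i x ν = r i x (ν i)) ∧ g = fun i x t => (r i x t : ℝ) := by
  refine ⟨fun i x t => p i x (WithLp.toLp 2 fun _ => t), fun i x ν => Subtype.ext ?_, ?_⟩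
  · rw [hg, hg]
  · ext i x t
    rw [hg]

theorem measurable_coordinate_prob
    (hp : ∀ i, Measurable fun z : EuclideanSpace ℝ (Fin d) × EuclideanSpace ℝ (Fin d) =>
      p i z.1 z.2)
    (hpr : ∀ i x ν, p i x ν = r i x (ν i)) (i : Fin d) (x : EuclideanSpace ℝ (Fin d)) :
    Measurable (r i x) := by
  have eq_const : r i x = fun t => p i x (WithLp.toLp 2 fun _ => t) := funext fun t => by rw [hpr]
  have const_measurable : Measurable fun t : ℝ => (x, WithLp.toLp 2 fun _ : Fin d => t) := by
    fun_prop
  exact eq_const ▸ (hp i).comp const_measurable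

theorem update_eq (hdiag : ∀ i j, i ≠ j → ∀ x, σ x i j = 0) (x ν : EuclideanSpace ℝ (Fin d)) :
    update Δt σ x ν
      = fun b => WithLp.toLp 2 fun i => x i + √Δt * σ x i i * (b i * ν i) := by
  ext b i
  have mulVec_apply : ((σ x).mulVec fun i => b i * ν i) i = σ x i i * (b i * ν i) := by
    rw [Matrix.mulVec, dotProduct]
    exact Finset.sum_eq_single i (fun j _ hj => by rw [hdiag i j hj.symm, zero_mul]) (by simp)
  simp [update, mulVec_apply, mul_assoc]

theorem map_update_flipLaw (hdiag : ∀ i j, i ≠ j → ∀ x, σ x i j = 0)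
    (x ν : EuclideanSpace ℝ (Fin d)) :
    (flipLaw p x ν).map (update Δt σ x ν) = (Measure.pi fun i => bernoulliMeasure
      (x i + √Δt * σ x i i * ν i) (x i - √Δt * σ x i i * ν i) (p i x ν)).map (WithLp.toLp 2) := by
  let coordinate_step (i : Fin d) (b : ℝ) : ℝ := x i + √Δt * σ x i i * (b * ν i)
  have step_measurable (i : Fin d) : Measurable (coordinate_step i) := by fun_prop
  have coordinate_law (i : Fin d) : (bernoulliMeasure 1 (-1) (p i x ν)).map (coordinate_step i)
      = bernoulliMeasure (x i + √Δt * σ x i i * ν i) (x i - √Δt * σ x i i * ν i) (p i x ν) := by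
    rw [map_bernoulliMeasure' _ _ (step_measurable i)]
    simp [coordinate_step, sub_eq_add_neg]
  have (i : Fin d) : IsProbabilityMeasure
      ((bernoulliMeasure 1 (-1) (p i x ν)).map (coordinate_step i)) :=
    Measure.isProbabilityMeasure_map (step_measurable i).aemeasurable
  simp only [← coordinate_law]
  rw [← Measure.pi_map_pi fun i => (step_measurable i).aemeasurable,
    Measure.map_map (by fun_prop) (by fun_prop), update_eq hdiag]
  rfl

theorem kernel_apply_eq_map_pi {hσ : ∀ i j, Measurable fun x => σ x i j}
    {hp : ∀ i, Measurable fun z : EuclideanSpace ℝ (Fin d) × EuclideanSpace ℝ (Fin d) =>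
      p i z.1 z.2}
    (hdiag : ∀ i j, i ≠ j → ∀ x, σ x i j = 0) (hpr : ∀ i x ν, p i x ν = r i x (ν i))
    (x : EuclideanSpace ℝ (Fin d)) :
    kernel Δt σ p hσ hp x
      = (Measure.pi fun i => skewGaussian (x i) (√Δt * σ x i i) (r i x)).map (WithLp.toLp 2) := by
  have step_measurable (i : Fin d) := measurable_bernoulliMeasure_step (x i) (√Δt * σ x i i)
    (measurable_coordinate_prob hp hpr i x)
  have map_measurable : Measurable fun ν => (flipLaw p x ν).map (update Δt σ x ν) :=
    (measurable_map_flipLaw Δt hσ hp).comp measurable_prodMk_left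
  refine Measure.ext fun A hA => ?_
  have apply_measurable : Measurable fun ν => (flipLaw p x ν).map (update Δt σ x ν) A :=
    (Measure.measurable_coe hA).comp map_measurable
  have hA' := measurableSet_preimage
    (by fun_prop : Measurable (WithLp.toLp 2 : (Fin d → ℝ) → EuclideanSpace ℝ (Fin d))) hA
  change stepLaw Δt σ p x A = _
  simp only [skewGaussian]
  rw [stepLaw, Measure.bind_apply hA map_measurable.aemeasurable, ← map_pi_eq_stdGaussian,
    lintegral_map apply_measurable (by fun_prop),
    ← bind_pi_pi _ step_measurable, Measure.map_apply (by fun_prop) hA,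
    Measure.bind_apply hA' (measurable_measure_pi step_measurable).aemeasurable]
  refine lintegral_congr fun ν => ?_
  rw [map_update_flipLaw hdiag, Measure.map_apply (by fun_prop) hA]
  simp only [hpr]

theorem lintegral_kernel_apply {hσ : ∀ i j, Measurable fun x => σ x i j}
    {hp : ∀ i, Measurable fun z : EuclideanSpace ℝ (Fin d) × EuclideanSpace ℝ (Fin d) =>
      p i z.1 z.2}
    (hdiag : ∀ i j, i ≠ j → ∀ x, σ x i j = 0) (hpr : ∀ i x ν, p i x ν = r i x (ν i))
    (x : EuclideanSpace ℝ (Fin d)) (i : Fin d) {f : ℝ → ENNReal} (hf : Measurable f) :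
    ∫⁻ y, f (y i) ∂kernel Δt σ p hσ hp x
      = ∫⁻ t, f t ∂skewGaussian (x i) (√Δt * σ x i i) (r i x) := by
  have (i : Fin d) := isProbabilityMeasure_skewGaussian (x i) (√Δt * σ x i i)
    (measurable_coordinate_prob hp hpr i x)
  rw [kernel_apply_eq_map_pi hdiag hpr, lintegral_map (by fun_prop) (by fun_prop)]
  exact (measurePreserving_eval _ i).lintegral_comp hf

theorem exists_le_kernel_of_norm_le {hσ : ∀ i j, Measurable fun x => σ x i j}
    {hp : ∀ i, Measurable fun z : EuclideanSpace ℝ (Fin d) × EuclideanSpace ℝ (Fin d) =>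
      p i z.1 z.2}
    (hdiag : ∀ i j, i ≠ j → ∀ x, σ x i j = 0) (hpr : ∀ i x ν, p i x ν = r i x (ν i))
    {s₀ S : ℝ} (hs₀ : 0 < s₀) (hs₀S : s₀ ≤ S)
    (hs : ∀ i x, √Δt * σ x i i ∈ Icc s₀ S)
    (hr : ∀ i, ∀ K : Set (EuclideanSpace ℝ (Fin d) × ℝ), IsCompact K →
      ∃ ε > 0, ∀ z ∈ K, ε ≤ (r i z.1 z.2 : ℝ)) (R : ℝ) :
    ∃ η : Measure (EuclideanSpace ℝ (Fin d)), IsFiniteMeasure η ∧ NeZero η ∧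
      ∀ x, ‖x‖ ≤ R → η ≤ kernel Δt σ p hσ hp x := by
  let ρ := (R + 1) / s₀
  choose ε hε0 hε using fun i => hr i (Metric.closedBall 0 R ×ˢ Icc (-ρ) ρ)
    ((isCompact_closedBall _ _).prod isCompact_Icc)
  let θ (i : Fin d) : Measure ℝ := (ENNReal.ofReal (ε i)
    * ENNReal.ofReal (gaussianLowerBound s₀ S R)) • volume.restrict (Icc (-1) 1)
  have (i : Fin d) : IsFiniteMeasure (θ i) := Measure.smul_finite _ (by finiteness)
  have θ_univ (i : Fin d) : θ i univ ≠ 0 := by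
    simp [θ, hε0 i, gaussianLowerBound_pos (hs₀.trans_le hs₀S)]
  refine ⟨(Measure.pi θ).map (WithLp.toLp 2), inferInstance, ⟨?_⟩, fun x hx => ?_⟩
  · rw [← Measure.measure_univ_ne_zero, Measure.map_apply (by fun_prop) .univ, preimage_univ,
      Measure.pi_univ]
    exact Finset.prod_ne_zero_iff.2 fun i _ => θ_univ i
  · rw [kernel_apply_eq_map_pi hdiag hpr]
    refine Measure.map_mono (measure_pi_mono fun i => ?_) (by fun_prop)
    exact smul_volume_restrict_le_skewGaussian (measurable_coordinate_prob hp hpr i x) hs₀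
      (hs i x).1 (hs i x).2 ((PiLp.norm_apply_le x i).trans hx) fun t ht =>
        hε i (x, t) ⟨mem_closedBall_zero_iff.2 hx, ht⟩

end Kernel

section InwardDrift

variable {d : ℕ} {μ : EuclideanSpace ℝ (Fin d) → EuclideanSpace ℝ (Fin d)}
  {r : Fin d → EuclideanSpace ℝ (Fin d) → ℝ → unitInterval}

theorem abs_apply_le_supNorm (x : EuclideanSpace ℝ (Fin d)) (i : Fin d) : |x i| ≤ supNorm x :=
  norm_le_pi_norm (WithLp.ofLp x) i

theorem supNorm_nonneg (x : EuclideanSpace ℝ (Fin d)) : 0 ≤ supNorm x := norm_nonneg _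

theorem norm_le_mul_supNorm (x : EuclideanSpace ℝ (Fin d)) : ‖x‖ ≤ d * supNorm x := by
  have supNorm_nonneg := supNorm_nonneg x
  rw [EuclideanSpace.norm_eq]
  refine Real.sqrt_le_iff.2 ⟨by positivity, ?_⟩
  calc ∑ i, ‖x i‖ ^ 2 ≤ ∑ _i : Fin d, supNorm x ^ 2 :=
        Finset.sum_le_sum fun i _ => by gcongr; exact abs_apply_le_supNorm x i
    _ = d * supNorm x ^ 2 := by simp
    _ ≤ (d * supNorm x) ^ 2 := by
        rw [mul_pow]
        gcongr
        exact_mod_cast Nat.le_self_pow two_ne_zero d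

theorem outwardProb_le_of_drift {h u t m T ε : ℝ} (hε : 0 < ε) (hT : 0 ≤ T) (hu : u ≠ 0)
    (ht : ε ≤ |t|) (hneg : u < 0 → T / ε ≤ m) (hpos : 0 < u → m ≤ -(T / ε))
    (h_one : T ≤ t * m → 1 - h ≤ ε) (h_zero : t * m ≤ -T → h ≤ ε) : outwardProb h u t ≤ ε := by
  have le_abs_mul {a : ℝ} (ha : T / ε ≤ a) : T ≤ |t| * a :=
    calc T = ε * (T / ε) := (mul_div_cancel₀ T hε.ne').symm
      _ ≤ |t| * a := mul_le_mul ht ha (div_nonneg hT hε.le) (abs_nonneg t)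
  unfold outwardProb
  split_ifs with hut <;> rcases hu.lt_or_gt with hu | hu
  · have := le_abs_mul (hneg hu)
    rw [abs_of_nonpos (nonpos_of_mul_nonneg_right hut hu)] at this
    exact h_zero (by linarith)
  · have := le_abs_mul (le_neg_of_le_neg (hpos hu))
    rw [abs_of_nonneg (nonneg_of_mul_nonneg_right hut hu)] at this
    exact h_zero (by linarith)
  · have := le_abs_mul (hneg hu)
    rw [abs_of_pos (pos_of_mul_neg_right (not_le.1 hut) hu.le)] at this
    exact h_one (by linarith)
  · have := le_abs_mul (le_neg_of_le_neg (hpos hu))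
    rw [abs_of_neg (neg_of_mul_neg_right (not_le.1 hut) hu.le)] at this
    exact h_one (by linarith)

theorem exists_threshold {α : Type*} {w h : α → ℝ} (h_one : Tendsto h (comap w atTop) (𝓝 1))
    (h_zero : Tendsto h (comap w atBot) (𝓝 0)) {ε : ℝ} (hε : 0 < ε) :
    ∃ T, 0 ≤ T ∧ ∀ z, (T ≤ w z → 1 - h z ≤ ε) ∧ (w z ≤ -T → h z ≤ ε) := by
  have near_one := h_one.eventually (lt_mem_nhds (sub_lt_self 1 hε))
  have near_zero := h_zero.eventually (gt_mem_nhds hε)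
  rw [eventually_comap] at near_one near_zero
  obtain ⟨T₁, hT₁⟩ := eventually_atTop.1 near_one
  obtain ⟨T₂, hT₂⟩ := eventually_atBot.1 near_zero
  refine ⟨max 0 (max T₁ (-T₂)), le_max_left _ _, fun z => ⟨fun hz => ?_, fun hz => ?_⟩⟩
  · have := hT₁ (w z) (by grind) z rfl
    linarith
  · exact (hT₂ (w z) (by grind) z rfl).le

/-- The limiting behaviour of the sign probabilities `r i x t` (coordinate `i`, state `x`, noise
`t`) on which the Lyapunov argument rests: far from the origin, each coordinate which is large
relative to the others moves outwards with small probability, unless the noise is small. -/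
def PushesInward (r : Fin d → EuclideanSpace ℝ (Fin d) → ℝ → unitInterval) : Prop :=
  ∀ ε > 0, ∃ R, ∀ x, R < ‖x‖ → ∀ i, supNorm x / 2 < |x i| →
    ∀ t, ε ≤ |t| → outwardProb (r i x t) (x i) t ≤ ε

theorem pushesInward_of_tendsto
    (hdrift_neg : ∀ i, Tendsto (fun x => μ x i)
      (Bornology.cobounded (EuclideanSpace ℝ (Fin d)) ⊓ 𝓟 {x | x i < -supNorm x / 2}) atTop)
    (hdrift_pos : ∀ i, Tendsto (fun x => μ x i)
      (Bornology.cobounded (EuclideanSpace ℝ (Fin d)) ⊓ 𝓟 {x | supNorm x / 2 < x i}) atBot)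
    (hr_one : ∀ i, Tendsto (fun z : EuclideanSpace ℝ (Fin d) × ℝ => (r i z.1 z.2 : ℝ))
      (comap (fun z => z.2 * μ z.1 i) atTop) (𝓝 1))
    (hr_zero : ∀ i, Tendsto (fun z : EuclideanSpace ℝ (Fin d) × ℝ => (r i z.1 z.2 : ℝ))
      (comap (fun z => z.2 * μ z.1 i) atBot) (𝓝 0)) : PushesInward r := by
  intro ε hε
  choose T hT0 hT using fun i => exists_threshold (hr_one i) (hr_zero i) hε
  have eventually_drift : ∀ᶠ x in Bornology.cobounded (EuclideanSpace ℝ (Fin d)), ∀ i,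
      (x i < -supNorm x / 2 → T i / ε ≤ μ x i) ∧ (supNorm x / 2 < x i → μ x i ≤ -(T i / ε)) := by
    refine eventually_all.2 fun i => ?_
    have drift_neg := (hdrift_neg i).eventually (eventually_ge_atTop (T i / ε))
    have drift_pos := (hdrift_pos i).eventually (eventually_le_atBot (-(T i / ε)))
    rw [eventually_inf_principal] at drift_neg drift_pos
    exact drift_neg.and drift_pos
  rw [← comap_norm_atTop, eventually_comap] at eventually_drift
  obtain ⟨R, hR⟩ := eventually_atTop.1 eventually_drift
  refine ⟨R, fun x hx i hi t ht => ?_⟩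
  obtain ⟨drift_neg, drift_pos⟩ := hR ‖x‖ hx.le x rfl i
  have half_nonneg : 0 ≤ supNorm x / 2 := div_nonneg (supNorm_nonneg x) zero_le_two
  refine outwardProb_le_of_drift hε (hT0 i) (abs_pos.1 (half_nonneg.trans_lt hi)) ht
    (fun hu => drift_neg ?_) (fun hu => drift_pos ?_) (hT i (x, t)).1 (hT i (x, t)).2
  · rw [abs_of_neg hu] at hi
    linarith
  · rwa [abs_of_pos hu] at hi

end InwardDrift

section Lyapunov

variable {d : ℕ}

/-- The Lyapunov function of the scheme; the summand `1` keeps it at least `1` also if `d = 0`. -/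
noncomputable def weight (x : EuclideanSpace ℝ (Fin d)) : ℝ := 1 + ∑ i, Real.cosh (x i)

theorem measurable_weight : Measurable (weight : EuclideanSpace ℝ (Fin d) → ℝ) := by
  unfold weight
  fun_prop

theorem one_le_weight (x : EuclideanSpace ℝ (Fin d)) : 1 ≤ weight x :=
  le_add_of_nonneg_right (Finset.sum_nonneg fun _ _ => (Real.cosh_pos _).le)

theorem cosh_supNorm_le_weight (x : EuclideanSpace ℝ (Fin d)) :
    Real.cosh (supNorm x) ≤ weight x := by
  rcases isEmpty_or_nonempty (Fin d) with _ | _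
  · have : supNorm x = 0 := by rw [supNorm, Subsingleton.elim x.ofLp 0, norm_zero]
    simpa [this] using one_le_weight x
  · obtain ⟨i, hi⟩ := Finite.exists_max fun i => |x i|
    calc Real.cosh (supNorm x) ≤ Real.cosh (x i) := by
          rw [Real.cosh_le_cosh, abs_of_nonneg (supNorm_nonneg x)]
          exact (pi_norm_le_iff_of_nonneg (abs_nonneg _)).2 hi
      _ ≤ ∑ j, Real.cosh (x j) := Finset.single_le_sum
          (f := fun j => Real.cosh (x j)) (fun _ _ => (Real.cosh_pos _).le) (Finset.mem_univ i)
      _ ≤ weight x := le_add_of_nonneg_left zero_le_one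

theorem norm_pow_le_mul_weight (k : ℕ) (x : EuclideanSpace ℝ (Fin d)) :
    ‖x‖ ^ k ≤ d ^ k * (k.factorial * (2 * weight x)) := by
  have supNorm_nonneg := supNorm_nonneg x
  have exp_le : Real.exp (supNorm x) ≤ 2 * Real.cosh (supNorm x) := by
    linarith [Real.cosh_eq (supNorm x), Real.exp_pos (-supNorm x)]
  have pow_le : supNorm x ^ k ≤ k.factorial * Real.exp (supNorm x) := by
    rw [← div_le_iff₀' (by positivity)]
    exact Real.pow_div_factorial_le_exp _ supNorm_nonneg k
  calc ‖x‖ ^ k ≤ (d * supNorm x) ^ k := by gcongr; exact norm_le_mul_supNorm x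
    _ = d ^ k * supNorm x ^ k := mul_pow _ _ _
    _ ≤ d ^ k * (k.factorial * (2 * weight x)) := by
        gcongr
        refine pow_le.trans ?_
        gcongr
        linarith [cosh_supNorm_le_weight x]

theorem integrable_norm_pow {ν : Measure (EuclideanSpace ℝ (Fin d))} (h : Integrable weight ν)
    (k : ℕ) : Integrable (fun x => ‖x‖ ^ k) ν := by
  refine Integrable.mono' (g := fun x => d ^ k * (k.factorial * (2 * weight x)))
    (((h.const_mul 2).const_mul _).const_mul _) (by fun_prop) (Eventually.of_forall fun x => ?_)
  rw [Real.norm_of_nonneg (by positivity)]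
  exact norm_pow_le_mul_weight k x

theorem lintegral_weight_le {ν : Measure (EuclideanSpace ℝ (Fin d))} [IsProbabilityMeasure ν]
    {a : Fin d → ℝ} (ha : ∀ i, 0 ≤ a i)
    (h : ∀ i, ∫⁻ y, ENNReal.ofReal (Real.cosh (y i)) ∂ν ≤ ENNReal.ofReal (a i)) :
    ∫⁻ y, ENNReal.ofReal (weight y) ∂ν ≤ ENNReal.ofReal (1 + ∑ i, a i) := by
  have ofReal_weight (y : EuclideanSpace ℝ (Fin d)) :
      ENNReal.ofReal (weight y) = 1 + ∑ i, ENNReal.ofReal (Real.cosh (y i)) := by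
    rw [weight, ENNReal.ofReal_add zero_le_one (Finset.sum_nonneg fun _ _ => (Real.cosh_pos _).le),
      ENNReal.ofReal_sum_of_nonneg fun _ _ => (Real.cosh_pos _).le, ENNReal.ofReal_one]
  simp only [ofReal_weight]
  rw [lintegral_add_left measurable_const, lintegral_finsetSum _ (by fun_prop), lintegral_one,
    measure_univ, ENNReal.ofReal_add zero_le_one (Finset.sum_nonneg fun i _ => ha i),
    ENNReal.ofReal_sum_of_nonneg fun i _ => ha i, ENNReal.ofReal_one]
  exact add_le_add_right (Finset.sum_le_sum fun i _ => h i) 1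

theorem mul_cosh_half_le (c : ℝ) {δ : ℝ} (hδ : 0 < δ) (s : ℝ) :
    c * Real.cosh (s / 2) ≤ δ * Real.cosh s + c ^ 2 / (4 * δ) := by
  have sq_le : Real.cosh (s / 2) ^ 2 ≤ Real.cosh s := by
    have := Real.cosh_two_mul (s / 2)
    rw [mul_div_cancel₀ s two_ne_zero] at this
    linarith [sq_nonneg (Real.sinh (s / 2))]
  have young : c * Real.cosh (s / 2) ≤ δ * Real.cosh (s / 2) ^ 2 + c ^ 2 / (4 * δ) := by
    have : 0 ≤ (2 * δ * Real.cosh (s / 2) - c) ^ 2 / (4 * δ) := by positivity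
    have expand : (2 * δ * Real.cosh (s / 2) - c) ^ 2 / (4 * δ)
        = δ * Real.cosh (s / 2) ^ 2 + c ^ 2 / (4 * δ) - c * Real.cosh (s / 2) := by
      field_simp
      ring
    linarith
  linarith [mul_le_mul_of_nonneg_left sq_le hδ.le]

theorem integral_damping_nonneg {s₀ S ε : ℝ} (hS : 0 ≤ S) (hε : 0 ≤ ε) :
    0 ≤ ∫ t, damping s₀ S ε t ∂gaussianReal 0 1 := by
  refine integral_nonneg fun t => ?_
  have : 0 ≤ Real.sinh (S * |t|) := Real.sinh_nonneg_iff.2 (by positivity)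
  have : 0 ≤ Real.sinh (S * ε) := Real.sinh_nonneg_iff.2 (by positivity)
  rw [Pi.zero_apply, damping]
  positivity

variable {Δt : ℝ} {σ : EuclideanSpace ℝ (Fin d) → Matrix (Fin d) (Fin d) ℝ}
  {p : Fin d → EuclideanSpace ℝ (Fin d) → EuclideanSpace ℝ (Fin d) → unitInterval}
  {r : Fin d → EuclideanSpace ℝ (Fin d) → ℝ → unitInterval}
  {hσ : ∀ i j, Measurable fun x => σ x i j}
  {hp : ∀ i, Measurable fun z : EuclideanSpace ℝ (Fin d) × EuclideanSpace ℝ (Fin d) =>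
    p i z.1 z.2}
  {s₀ S : ℝ}

theorem lintegral_cosh_kernel_le (hdiag : ∀ i j, i ≠ j → ∀ x, σ x i j = 0)
    (hpr : ∀ i x ν, p i x ν = r i x (ν i)) (hs₀ : 0 < s₀)
    (hs : ∀ i x, √Δt * σ x i i ∈ Icc s₀ S) {ε : ℝ} (hε : 0 ≤ ε) {x : EuclideanSpace ℝ (Fin d)}
    {i : Fin d} (hw : ∀ t, ε ≤ |t| → outwardProb (r i x t) (x i) t ≤ ε) :
    ∫⁻ y, ENNReal.ofReal (Real.cosh (y i)) ∂kernel Δt σ p hσ hp x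
      ≤ ENNReal.ofReal ((∫ t, damping s₀ S ε t ∂gaussianReal 0 1) * Real.cosh (x i)
        + ∫ t, Real.sinh (S * |t|) ∂gaussianReal 0 1) := by
  rw [lintegral_kernel_apply hdiag hpr x i (f := fun t => ENNReal.ofReal (Real.cosh t))
    (by fun_prop)]
  exact lintegral_cosh_skewGaussian_le (measurable_coordinate_prob hp hpr i x) hs₀ (hs i x).1
    (hs i x).2 hε hw

-- A coordinate that is not pushed inwards is at most `supNorm x / 2`, up to a constant, so the
-- crude bound `ε = 1` on its mean is of the order of the square root of the Lyapunov function.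
theorem exists_forall_lintegral_cosh_kernel_le (hdiag : ∀ i j, i ≠ j → ∀ x, σ x i j = 0)
    (hpr : ∀ i x ν, p i x ν = r i x (ν i)) (hs₀ : 0 < s₀) (hs₀S : s₀ ≤ S)
    (hs : ∀ i x, √Δt * σ x i i ∈ Icc s₀ S) (hr : PushesInward r) :
    ∃ q c, 0 ≤ q ∧ q < 1 ∧ 0 ≤ c ∧ ∀ x i,
      ∫⁻ y, ENNReal.ofReal (Real.cosh (y i)) ∂kernel Δt σ p hσ hp x
        ≤ ENNReal.ofReal (q * Real.cosh (x i) + c * Real.cosh (supNorm x / 2)) := by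
  have hS : 0 ≤ S := (hs₀.trans_le hs₀S).le
  obtain ⟨ε, hε, rate_lt_one⟩ := exists_integral_damping_lt_one hs₀ S
  obtain ⟨R, hR⟩ := hr ε hε
  set q := ∫ t, damping s₀ S ε t ∂gaussianReal 0 1
  set Q := ∫ t, damping s₀ S 1 t ∂gaussianReal 0 1
  set L := ∫ t, Real.sinh (S * |t|) ∂gaussianReal 0 1
  have q_nonneg : 0 ≤ q := integral_damping_nonneg hS hε.le
  have Q_nonneg : 0 ≤ Q := integral_damping_nonneg hS zero_le_one
  have L_nonneg : 0 ≤ L := integral_nonneg fun t => Real.sinh_nonneg_iff.2 (by positivity)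
  have cosh_R : 0 < Real.cosh R := Real.cosh_pos R
  refine ⟨q, Q * (Real.cosh R + 1) + L, q_nonneg, rate_lt_one, by positivity, fun x i => ?_⟩
  have one_le : 1 ≤ Real.cosh (supNorm x / 2) := Real.one_le_cosh _
  have main_nonneg : 0 ≤ q * Real.cosh (x i) := mul_nonneg q_nonneg (Real.cosh_pos _).le
  have crude (hx : Real.cosh (x i) ≤ (Real.cosh R + 1) * Real.cosh (supNorm x / 2)) :
      ∫⁻ y, ENNReal.ofReal (Real.cosh (y i)) ∂kernel Δt σ p hσ hp x ≤ ENNReal.ofReal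
        (q * Real.cosh (x i) + (Q * (Real.cosh R + 1) + L) * Real.cosh (supNorm x / 2)) := by
    refine (lintegral_cosh_kernel_le hdiag hpr hs₀ hs zero_le_one fun t _ =>
      (outwardProb_mem_Icc (r i x t).2 (x i) t).2).trans (ENNReal.ofReal_le_ofReal ?_)
    linarith [mul_le_mul_of_nonneg_left hx Q_nonneg, le_mul_of_one_le_right L_nonneg one_le]
  rcases le_or_gt ‖x‖ R with near | far
  · refine crude ?_
    have : Real.cosh (x i) ≤ Real.cosh R :=
      Real.cosh_le_cosh.2 (((PiLp.norm_apply_le x i).trans near).trans (le_abs_self R))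
    nlinarith
  rcases le_or_gt |x i| (supNorm x / 2) with small | large
  · refine crude ?_
    have : Real.cosh (x i) ≤ Real.cosh (supNorm x / 2) :=
      Real.cosh_le_cosh.2 (small.trans (le_abs_self _))
    nlinarith
  · refine (lintegral_cosh_kernel_le hdiag hpr hs₀ hs hε.le (hR x far i large)).trans
      (ENNReal.ofReal_le_ofReal (add_le_add_right ?_ _))
    have : 0 ≤ Q * (Real.cosh R + 1) := by positivity
    nlinarith

theorem exists_hasGeometricDrift_kernel (hdiag : ∀ i j, i ≠ j → ∀ x, σ x i j = 0)
    (hpr : ∀ i x ν, p i x ν = r i x (ν i)) (hs₀ : 0 < s₀) (hs₀S : s₀ ≤ S)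
    (hs : ∀ i x, √Δt * σ x i i ∈ Icc s₀ S) (hr : PushesInward r) :
    ∃ γ K, HasGeometricDrift (kernel Δt σ p hσ hp) weight γ K := by
  obtain ⟨q, c, q_nonneg, rate_lt_one, c_nonneg, hqc⟩ :=
    exists_forall_lintegral_cosh_kernel_le (hσ := hσ) (hp := hp) hdiag hpr hs₀ hs₀S hs hr
  obtain ⟨δ, hδ, rate_add_lt_one⟩ : ∃ δ > 0, q + δ < 1 :=
    ⟨(1 - q) / 2, by linarith, by linarith⟩
  refine ⟨q + δ, 1 + (d * c) ^ 2 / (4 * δ), measurable_weight,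
    fun x => zero_le_one.trans (one_le_weight x), by positivity, rate_add_lt_one, by positivity,
    fun x => ?_⟩
  have bound_nonneg (i : Fin d) :
      0 ≤ q * Real.cosh (x i) + c * Real.cosh (supNorm x / 2) := by
    have := Real.cosh_pos (x i)
    have := Real.cosh_pos (supNorm x / 2)
    positivity
  refine (lintegral_weight_le bound_nonneg (hqc x)).trans (ENNReal.ofReal_le_ofReal ?_)
  calc 1 + ∑ i, (q * Real.cosh (x i) + c * Real.cosh (supNorm x / 2))
      = 1 + q * ∑ i, Real.cosh (x i) + (d * c) * Real.cosh (supNorm x / 2) := by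
        simp only [Finset.sum_add_distrib, ← Finset.mul_sum, Finset.sum_const, Finset.card_univ,
          Fintype.card_fin, nsmul_eq_mul]
        ring
    _ ≤ 1 + q * weight x + (δ * weight x + (d * c) ^ 2 / (4 * δ)) := by
        gcongr
        · exact le_add_of_nonneg_left zero_le_one
        · exact (mul_cosh_half_le _ hδ _).trans
            (by gcongr; exact cosh_supNorm_le_weight x)
    _ = (q + δ) * weight x + (1 + (d * c) ^ 2 / (4 * δ)) := by ring

theorem exists_le_kernel_of_weight_le (hdiag : ∀ i j, i ≠ j → ∀ x, σ x i j = 0)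
    (hpr : ∀ i x ν, p i x ν = r i x (ν i)) (hs₀ : 0 < s₀) (hs₀S : s₀ ≤ S)
    (hs : ∀ i x, √Δt * σ x i i ∈ Icc s₀ S)
    (hr : ∀ i, ∀ K : Set (EuclideanSpace ℝ (Fin d) × ℝ), IsCompact K →
      ∃ ε > 0, ∀ z ∈ K, ε ≤ (r i z.1 z.2 : ℝ)) (R : ℝ) :
    ∃ η : Measure (EuclideanSpace ℝ (Fin d)), IsFiniteMeasure η ∧ NeZero η ∧
      ∀ x, weight x ≤ R → η ≤ kernel Δt σ p hσ hp x := by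
  obtain ⟨η, hη_finite, hη_ne, hη⟩ := exists_le_kernel_of_norm_le (hσ := hσ) (hp := hp) hdiag hpr
    hs₀ hs₀S hs hr (d * (2 * R))
  refine ⟨η, hη_finite, hη_ne, fun x hx => hη x ?_⟩
  calc ‖x‖ ≤ d * (2 * weight x) := by simpa using norm_pow_le_mul_weight 1 x
    _ ≤ d * (2 * R) := by gcongr

end Lyapunov

end SkewSymmetric

theorem theorem4p2 {d : ℕ} (Δt : ℝ) (hΔt : 0 < Δt)
    (μ : EuclideanSpace ℝ (Fin d) → EuclideanSpace ℝ (Fin d))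
    (σ : EuclideanSpace ℝ (Fin d) → Matrix (Fin d) (Fin d) ℝ)
    (p : Fin d → EuclideanSpace ℝ (Fin d) → EuclideanSpace ℝ (Fin d) → unitInterval)
    (hσ : ∀ i j, Measurable fun x => σ x i j)
    (hp : ∀ i, Measurable fun z : EuclideanSpace ℝ (Fin d) × EuclideanSpace ℝ (Fin d) =>
      p i z.1 z.2)
    (hp01 : ∀ i x ν, 0 < p i x ν ∧ p i x ν < 1)
    -- the volatility is diagonal, and bounded above and below
    (hdiag : ∀ i j, i ≠ j → ∀ x, σ x i j = 0)
    (N M : ℝ) (hN : 0 < N) (hNM : N < M)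
    (hbound : ∀ i x, N ≤ σ x i i ∧ σ x i i ≤ M)
    -- the drift components are coordinatewise confining
    (hdrift_neg : ∀ i, Filter.Tendsto (fun x => μ x i)
      (Bornology.cobounded (EuclideanSpace ℝ (Fin d)) ⊓
        Filter.principal {x | x i < -SkewSymmetric.supNorm x / 2}) Filter.atTop)
    (hdrift_pos : ∀ i, Filter.Tendsto (fun x => μ x i)
      (Bornology.cobounded (EuclideanSpace ℝ (Fin d)) ⊓
        Filter.principal {x | SkewSymmetric.supNorm x / 2 < x i}) Filter.atBot)
    -- `p i` depends on `ν` only through `ν i`, with the stated limits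
    (g : Fin d → EuclideanSpace ℝ (Fin d) → ℝ → ℝ)
    (hg : ∀ i x ν, (p i x ν : ℝ) = g i x (ν i))
    (hg_compact : ∀ i, ∀ K : Set (EuclideanSpace ℝ (Fin d) × ℝ), IsCompact K →
      ∃ ε > 0, ∀ z ∈ K, ε ≤ g i z.1 z.2)
    (hg_one : ∀ i, Filter.Tendsto (fun z : EuclideanSpace ℝ (Fin d) × ℝ => g i z.1 z.2)
      (Filter.comap (fun z => z.2 * μ z.1 i) Filter.atTop) (nhds 1))
    (hg_zero : ∀ i, Filter.Tendsto (fun z : EuclideanSpace ℝ (Fin d) × ℝ => g i z.1 z.2)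
      (Filter.comap (fun z => z.2 * μ z.1 i) Filter.atBot) (nhds 0)) :
    ∃ (π : MeasureTheory.Measure (EuclideanSpace ℝ (Fin d)))
      (_ : MeasureTheory.IsProbabilityMeasure π),
      (SkewSymmetric.kernel Δt σ p hσ hp).Invariant π ∧
      (∀ k : ℕ, MeasureTheory.Integrable (fun x => ‖x‖ ^ k) π) ∧
      ∃ (C lam : ℝ) (V : EuclideanSpace ℝ (Fin d) → ℝ),
        0 < C ∧ 0 < lam ∧ (∀ x, 1 ≤ V x) ∧
        ∀ (n : ℕ) (x : EuclideanSpace ℝ (Fin d)),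
          SkewSymmetric.tvNorm ((SkewSymmetric.kernel Δt σ p hσ hp ^ n) x) π
            ≤ C * V x * Real.exp (-lam * n) := by
  obtain ⟨r, hpr, rfl⟩ := SkewSymmetric.exists_coordinate_prob hg
  have scale_pos : 0 < √Δt * N := mul_pos (Real.sqrt_pos.2 hΔt) hN
  have scale_le : √Δt * N ≤ √Δt * M := by gcongr
  have scale_mem (i : Fin d) (x : EuclideanSpace ℝ (Fin d)) :
      √Δt * σ x i i ∈ Set.Icc (√Δt * N) (√Δt * M) :=
    ⟨by gcongr; exact (hbound i x).1, by gcongr; exact (hbound i x).2⟩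
  have inward : SkewSymmetric.PushesInward r :=
    SkewSymmetric.pushesInward_of_tendsto hdrift_neg hdrift_pos hg_one hg_zero
  obtain ⟨γ, K, drift⟩ := SkewSymmetric.exists_hasGeometricDrift_kernel (hσ := hσ) (hp := hp)
    hdiag hpr scale_pos scale_le scale_mem inward
  obtain ⟨R, hR⟩ : ∃ R, 2 * K / (1 - γ) < R := exists_gt _
  obtain ⟨η, _, _, hη⟩ := SkewSymmetric.exists_le_kernel_of_weight_le (hσ := hσ) (hp := hp)
    hdiag hpr scale_pos scale_le scale_mem hg_compact R
  obtain ⟨π, hπ, invariant, integrable_weight, C, lam, hC, hlam, rate⟩ :=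
    drift.exists_invariant_tvNorm_le ((div_lt_iff₀' (sub_pos.2 drift.rate_lt_one)).1 hR) hη
  refine ⟨π, hπ, invariant, SkewSymmetric.integrable_norm_pow integrable_weight, C, lam,
    fun x => 1 + SkewSymmetric.weight x, hC, hlam, fun x => ?_, rate⟩
  linarith [SkewSymmetric.one_le_weight x]
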